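/- Let $\mathbb D$ be an equipment (framed bicategory): a pseudo double category in which every restriction $Q(g,f)$ exists, i.e. for all vertical arrows $f\colon a\to c$, $g\colon b\to d$ and every proarrow $Q\colon c\nrightarrow d$ there is a cartesian cell $Q(g,f)\Rightarrow Q$ with left frame $f$ and right frame $g$. Write $\odot$ for composition of proarrows in diagrammatic order and $U_x$ for the unit proarrow of $x$. A proarrow $P\colon c\nrightarrow d$ is represented by $f\colon c\to d$ if it comes with a cartesian cell $P\Rightarrow U_d$ with frames $(f,1_d)$; write $P\cong d(1,f)$. Dually $d(f,1)\colon d\nrightarrow c$. Definitions. A monoid $M\colon c\nrightarrow c$ is a monad in the horizontal bicategory $\mathcal H(\mathbb D)$; bimodules are defined likewise. An embedding $(f,\vec f)$ of $M$ into $x$ is a vertical arrow $f\colon c\to x$ with a cell $\vec f\colon M\Rightarrow U_x$, both frames $f$, respecting units and multiplications. An embedding of an $(M,N)$-bimodule $B$ into $P\colon x\nrightarrow y$ along embeddings $f\colon M\to x$, $g\colon N\to y$ is a cell $B\Rightarrow P$ with frames $f,g$ respecting both actions. A collapse of $M$ is an embedding $(i,\vec\imath)$ of $M$ through which every embedding factors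 as $(h\circ i,h\circ\vec\imath)$ for a unique vertical arrow $h$; a collapse of $B$ is an embedding of $B$ along collapses of $M$ and $N$ through which every embedding of $B$ factors uniquely. A collapse of $M$ is normal if $\vec\imath$ is also a collapse of the unit bimodule ${}_MM_M$. An embedding $(f,\vec f)$ with $\vec f$ cartesian exhibits $M$ as the kernel $\ker f$. A monoid is effective if it is a kernel; a bimodule is effective if it has an embedding $\phi$, along some $(f,\vec f)$ and $(g,\vec g)$, with $\vec f,\vec g,\phi$ all cartesian. A vertical arrow $f$ is a regular cover if $\ker f\Rightarrow U$ is a normal collapse. $\mathbb D$ is exact if 1. every effective monoid has a normal collapse; 2. for every proarrow $B\colon d\nrightarrow d'$ and all regular covers $f\colon c\to d$, $g\colon c'\to d'$, the cartesian embedding of the $(\ker f,\ker g)$-bimodule $B(g,f)$ into $B$ is a bimodule collapse; 3. every monoid and every bimodule in $\mathbb D$ is effective. $\mathbb D$ satisfies Wood's axiom 5 if for every monoid $M\colon c\nrightarrow c$ there are an object $c_M$, a vertical arrow $i\colon c\to c_M$ and a cell $\vec\imath\colon M\Rightarrow U_{c_M}$ with both frames $i$ such that 1. the corresponding cell $M\odot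 c_M(1,i)\Rightarrow c_M(1,i)$ makes $c_M(1,i)$ a universal left $M$-module: for every $b$, the functor $Y\mapsto c_M(1,i)\odot Y$ from $\mathcal H(\mathbb D)(c_M,b)$ to the category of left $M$-modules $c\nrightarrow b$ is an equivalence ($c_M$ is a Kleisli object); 2. the corresponding cell $c_M(i,1)\odot M\Rightarrow c_M(i,1)$ makes $c_M(i,1)$ a universal right $M$-module, in the dual sense ($c_M$ is an Eilenberg–Moore object); 3. a proarrow $P\colon c_M\nrightarrow d$ is representable if and only if $c_M(1,i)\odot P$ is. Moreover, if a cartesian cell $\xi\colon c_M(1,i)\odot P\Rightarrow U_d$ represents the latter by $g\colon c\to d$, then there is a unique $f\colon c_M\to d$ such that $f\circ i=g$ (an equality) and $P$ is represented by $f$ compatibly with $\xi$, i.e. by some cartesian cell $\psi\colon P\Rightarrow U_d$ with frames $(f,1_d)$ whose composite with the canonical cell $c_M(1,i)\odot P\Rightarrow P$ (frames $(i,1_d)$) is $\xi$. Theorem. An equipment $\mathbb D$ is exact if and only if it satisfies Wood's axiom 5. -/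

import Mathlib

/-! ## Monads, modules and bimodules in a bicategory

Composition of 1-cells is written in diagrammatic order: `X ≫ Y : a ⟶ c` for `X : a ⟶ b`,
`Y : b ⟶ c`. -/

namespace CategoryTheory.Bicategory

universe w₁ v₁ u₁

section

variable {B : Type u₁} [Bicategory.{w₁, v₁} B]

/-- A monad on the object `a` of a bicategory. -/
structure Mnd (a : B) where
  /-- the underlying 1-cell -/
  t : a ⟶ a
  /-- the unit -/
  η : 𝟙 a ⟶ t
  /-- the multiplication -/
  μ : t ≫ t ⟶ t
  η_μ : η ▷ t ≫ μ = (λ_ t).hom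
  μ_η : t ◁ η ≫ μ = (ρ_ t).hom
  assoc : μ ▷ t ≫ μ = (α_ t t t).hom ≫ t ◁ μ ≫ μ

/-- A left `M`-module with target `b`: a 1-cell `X : a ⟶ b` with an action `M ≫ X ⟶ X`. -/
structure LMod {a : B} (M : Mnd a) (b : B) where
  X : a ⟶ b
  act : M.t ≫ X ⟶ X
  unit_act : M.η ▷ X ≫ act = (λ_ X).hom
  mul_act : M.μ ▷ X ≫ act = (α_ M.t M.t X).hom ≫ M.t ◁ act ≫ act

/-- A right `M`-module with source `b`: a 1-cell `X : b ⟶ a` with an action `X ≫ M ⟶ X`. -/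
structure RMod {a : B} (M : Mnd a) (b : B) where
  X : b ⟶ a
  act : X ≫ M.t ⟶ X
  act_unit : X ◁ M.η ≫ act = (ρ_ X).hom
  act_mul : X ◁ M.μ ≫ act = (α_ X M.t M.t).inv ≫ act ▷ M.t ≫ act

/-- An `(M, N)`-bimodule. -/
structure Bimodule {a b : B} (M : Mnd a) (N : Mnd b) where
  X : a ⟶ b
  l : M.t ≫ X ⟶ X
  r : X ≫ N.t ⟶ X
  unit_l : M.η ▷ X ≫ l = (λ_ X).hom
  mul_l : M.μ ▷ X ≫ l = (α_ M.t M.t X).hom ≫ M.t ◁ l ≫ l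
  r_unit : X ◁ N.η ≫ r = (ρ_ X).hom
  r_mul : X ◁ N.μ ≫ r = (α_ X N.t N.t).inv ≫ r ▷ N.t ≫ r
  l_r : l ▷ N.t ≫ r = (α_ M.t X N.t).hom ≫ M.t ◁ r ≫ l

/-- The unit bimodule of a monad: the monad acting on itself from both sides. -/
def Bimodule.unit {a : B} (M : Mnd a) : Bimodule M M where
  X := M.t
  l := M.μ
  r := M.μ
  unit_l := M.η_μ
  mul_l := M.assoc
  r_unit := M.μ_η
  r_mul := by rw [M.assoc]; simp
  l_r := M.assoc

variable {a b : B} {M : Mnd a}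

/-- Morphisms of left modules over a fixed target: 2-cells commuting with the actions. -/
@[ext]
structure LMod.Hom (X Y : LMod M b) where
  hom : X.X ⟶ Y.X
  comm : X.act ≫ hom = M.t ◁ hom ≫ Y.act

instance : Category (LMod M b) where
  Hom := LMod.Hom
  id X := { hom := 𝟙 X.X, comm := by simp }
  comp f g :=
    { hom := f.hom ≫ g.hom
      comm := by rw [← Category.assoc, f.comm, Category.assoc, g.comm]; simp }
  id_comp _ := by apply LMod.Hom.ext; simp
  comp_id _ := by apply LMod.Hom.ext; simp
  assoc _ _ _ := by apply LMod.Hom.ext; simp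

/-- Morphisms of right modules over a fixed source: 2-cells commuting with the actions. -/
@[ext]
structure RMod.Hom (X Y : RMod M b) where
  hom : X.X ⟶ Y.X
  comm : X.act ≫ hom = hom ▷ M.t ≫ Y.act

instance : Category (RMod M b) where
  Hom := RMod.Hom
  id X := { hom := 𝟙 X.X, comm := by simp }
  comp f g :=
    { hom := f.hom ≫ g.hom
      comm := by rw [← Category.assoc, f.comm, Category.assoc, g.comm]; simp }
  id_comp _ := by apply RMod.Hom.ext; simp
  comp_id _ := by apply RMod.Hom.ext; simp
  assoc _ _ _ := by apply RMod.Hom.ext; simp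

/-- Composing a left module `L` with target `q` with 1-cells out of `q`. -/
def LMod.extend {q : B} (L : LMod M q) (b : B) : (q ⟶ b) ⥤ LMod M b where
  obj Y :=
    { X := L.X ≫ Y
      act := (α_ M.t L.X Y).inv ≫ L.act ▷ Y
      unit_act := by
        have h := congrArg (fun t => t ▷ Y) L.unit_act
        simp only [comp_whiskerRight] at h
        simp [h]
      mul_act := by
        have h := congrArg (fun t => t ▷ Y) L.mul_act
        simp only [comp_whiskerRight] at h
        simp [h] }
  map ψ :=
    { hom := L.X ◁ ψ
      comm := by
        have h := whisker_exchange L.act ψ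
        simp [← h] }
  map_id _ := by apply LMod.Hom.ext; exact whiskerLeft_id _ _
  map_comp _ _ := by apply LMod.Hom.ext; exact whiskerLeft_comp _ _ _

/-- Composing 1-cells into `q` with a right module `R` with source `q`. -/
def RMod.extend {q : B} (R : RMod M q) (b : B) : (b ⟶ q) ⥤ RMod M b where
  obj Y :=
    { X := Y ≫ R.X
      act := (α_ Y R.X M.t).hom ≫ Y ◁ R.act
      act_unit := by
        have h := congrArg (fun t => Y ◁ t) R.act_unit
        simp only [whiskerLeft_comp] at h
        simp [h]
      act_mul := by
        have h := congrArg (fun t => Y ◁ t) R.act_mul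
        simp only [whiskerLeft_comp] at h
        simp [h] }
  map ψ :=
    { hom := ψ ▷ R.X
      comm := by simp [whisker_exchange] }
  map_id _ := by apply RMod.Hom.ext; exact id_whiskerRight _ _
  map_comp _ _ := by apply RMod.Hom.ext; exact comp_whiskerRight _ _ _

/-- `L : a ⟶ q` is a universal left `M`-module, i.e. it exhibits `q` as a Kleisli object of `M`:
composition with `L` is an equivalence from `B(q, b)` to left `M`-modules with target `b`,
for every `b`. -/
def LMod.IsUniversal {q : B} (L : LMod M q) : Prop :=
  ∀ b : B, (L.extend b).IsEquivalence

/-- `R : q ⟶ a` is a universal right `M`-module, i.e. it exhibits `q` as an Eilenberg–Moore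
object of `M`. -/
def RMod.IsUniversal {q : B} (R : RMod M q) : Prop :=
  ∀ b : B, (R.extend b).IsEquivalence

end

end CategoryTheory.Bicategory

/-! ## Pseudo double categories and equipments -/

open CategoryTheory

universe z w v u

set_option linter.checkUnivs false in
/-- A (pseudo) double category. The category structure on `D` is the vertical category;
`Pro a b` are the proarrows `a ⇸ b`; `Cell f g A B` are the cells with source `A`, target `B`,
left frame `f` and right frame `g`. Vertical composition is strictly associative and unital,
horizontal composition `hcomp` (in diagrammatic order) only up to coherent invertible cells.

Vertical composition of cells takes as extra arguments names `h`, `k` for the composite frames,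
with proofs that they are the composites, so that the strict laws can be stated as equations
in one type of cells. -/
class DoubleCategory (D : Type u) extends Category.{v} D where
  Pro : D → D → Type w
  Cell : ∀ {a b a' b' : D}, (a ⟶ a') → (b ⟶ b') → Pro a b → Pro a' b' → Type z
  -- vertical structure
  idCell : ∀ {a b : D} (A : Pro a b), Cell (𝟙 a) (𝟙 b) A A
  vcomp : ∀ {a b a' b' a'' b'' : D} {f : a ⟶ a'} {g : b ⟶ b'} {f' : a' ⟶ a''} {g' : b' ⟶ b''}
    {A : Pro a b} {A' : Pro a' b'} {A'' : Pro a'' b''} {h : a ⟶ a''} {k : b ⟶ b''}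
    (_ : Cell f g A A') (_ : Cell f' g' A' A'') (_ : f ≫ f' = h) (_ : g ≫ g' = k),
    Cell h k A A''
  id_vcomp : ∀ {a b a' b' : D} {f : a ⟶ a'} {g : b ⟶ b'} {A : Pro a b} {A' : Pro a' b'}
    (φ : Cell f g A A'), vcomp (idCell A) φ (Category.id_comp f) (Category.id_comp g) = φ
  vcomp_id : ∀ {a b a' b' : D} {f : a ⟶ a'} {g : b ⟶ b'} {A : Pro a b} {A' : Pro a' b'}
    (φ : Cell f g A A'), vcomp φ (idCell A') (Category.comp_id f) (Category.comp_id g) = φ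
  vcomp_assoc : ∀ {a₀ b₀ a₁ b₁ a₂ b₂ a₃ b₃ : D}
    {f₁ : a₀ ⟶ a₁} {g₁ : b₀ ⟶ b₁} {f₂ : a₁ ⟶ a₂} {g₂ : b₁ ⟶ b₂} {f₃ : a₂ ⟶ a₃} {g₃ : b₂ ⟶ b₃}
    {A₀ : Pro a₀ b₀} {A₁ : Pro a₁ b₁} {A₂ : Pro a₂ b₂} {A₃ : Pro a₃ b₃}
    (φ₁ : Cell f₁ g₁ A₀ A₁) (φ₂ : Cell f₂ g₂ A₁ A₂) (φ₃ : Cell f₃ g₃ A₂ A₃)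
    {f₁₂ : a₀ ⟶ a₂} {g₁₂ : b₀ ⟶ b₂} {f₂₃ : a₁ ⟶ a₃} {g₂₃ : b₁ ⟶ b₃}
    {h : a₀ ⟶ a₃} {k : b₀ ⟶ b₃}
    (p₁₂ : f₁ ≫ f₂ = f₁₂) (q₁₂ : g₁ ≫ g₂ = g₁₂) (p₂₃ : f₂ ≫ f₃ = f₂₃) (q₂₃ : g₂ ≫ g₃ = g₂₃)
    (p : f₁₂ ≫ f₃ = h) (q : g₁₂ ≫ g₃ = k) (p' : f₁ ≫ f₂₃ = h) (q' : g₁ ≫ g₂₃ = k),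
    vcomp (vcomp φ₁ φ₂ p₁₂ q₁₂) φ₃ p q = vcomp φ₁ (vcomp φ₂ φ₃ p₂₃ q₂₃) p' q'
  -- horizontal units
  U : ∀ a : D, Pro a a
  unitCell : ∀ {a b : D} (f : a ⟶ b), Cell f f (U a) (U b)
  unitCell_id : ∀ a : D, unitCell (𝟙 a) = idCell (U a)
  unitCell_comp : ∀ {a b c : D} (f : a ⟶ b) (g : b ⟶ c),
    unitCell (f ≫ g) = vcomp (unitCell f) (unitCell g) rfl rfl
  -- horizontal composition
  pcomp : ∀ {a b c : D}, Pro a b → Pro b c → Pro a c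
  hcomp : ∀ {a b c a' b' c' : D} {f : a ⟶ a'} {g : b ⟶ b'} {h : c ⟶ c'}
    {A : Pro a b} {B : Pro b c} {A' : Pro a' b'} {B' : Pro b' c'}
    (_ : Cell f g A A') (_ : Cell g h B B'), Cell f h (pcomp A B) (pcomp A' B')
  hcomp_id : ∀ {a b c : D} (A : Pro a b) (B : Pro b c),
    hcomp (idCell A) (idCell B) = idCell (pcomp A B)
  interchange : ∀ {a b c a' b' c' a'' b'' c'' : D}
    {f : a ⟶ a'} {g : b ⟶ b'} {h : c ⟶ c'} {f' : a' ⟶ a''} {g' : b' ⟶ b''} {h' : c' ⟶ c''}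
    {A : Pro a b} {B : Pro b c} {A' : Pro a' b'} {B' : Pro b' c'}
    {A'' : Pro a'' b''} {B'' : Pro b'' c''}
    {ff : a ⟶ a''} {gg : b ⟶ b''} {hh : c ⟶ c''}
    (φ : Cell f g A A') (ψ : Cell g h B B') (φ' : Cell f' g' A' A'') (ψ' : Cell g' h' B' B'')
    (p : f ≫ f' = ff) (q : g ≫ g' = gg) (r : h ≫ h' = hh),
    hcomp (vcomp φ φ' p q) (vcomp ψ ψ' q r) = vcomp (hcomp φ ψ) (hcomp φ' ψ') p r
  -- associator
  assocHom : ∀ {a b c d : D} (A : Pro a b) (B : Pro b c) (C : Pro c d),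
    Cell (𝟙 a) (𝟙 d) (pcomp (pcomp A B) C) (pcomp A (pcomp B C))
  assocInv : ∀ {a b c d : D} (A : Pro a b) (B : Pro b c) (C : Pro c d),
    Cell (𝟙 a) (𝟙 d) (pcomp A (pcomp B C)) (pcomp (pcomp A B) C)
  assoc_hom_inv : ∀ {a b c d : D} (A : Pro a b) (B : Pro b c) (C : Pro c d),
    vcomp (assocHom A B C) (assocInv A B C) (Category.comp_id _) (Category.comp_id _) = idCell _
  assoc_inv_hom : ∀ {a b c d : D} (A : Pro a b) (B : Pro b c) (C : Pro c d),
    vcomp (assocInv A B C) (assocHom A B C) (Category.comp_id _) (Category.comp_id _) = idCell _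
  assoc_natural : ∀ {a b c d a' b' c' d' : D}
    {f : a ⟶ a'} {g : b ⟶ b'} {h : c ⟶ c'} {k : d ⟶ d'}
    {A : Pro a b} {B : Pro b c} {C : Pro c d} {A' : Pro a' b'} {B' : Pro b' c'} {C' : Pro c' d'}
    (φ : Cell f g A A') (ψ : Cell g h B B') (χ : Cell h k C C'),
    vcomp (hcomp (hcomp φ ψ) χ) (assocHom A' B' C') (Category.comp_id f) (Category.comp_id k) =
      vcomp (assocHom A B C) (hcomp φ (hcomp ψ χ)) (Category.id_comp f) (Category.id_comp k)
  -- unitors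
  lunitHom : ∀ {a b : D} (A : Pro a b), Cell (𝟙 a) (𝟙 b) (pcomp (U a) A) A
  lunitInv : ∀ {a b : D} (A : Pro a b), Cell (𝟙 a) (𝟙 b) A (pcomp (U a) A)
  lunit_hom_inv : ∀ {a b : D} (A : Pro a b),
    vcomp (lunitHom A) (lunitInv A) (Category.comp_id _) (Category.comp_id _) = idCell _
  lunit_inv_hom : ∀ {a b : D} (A : Pro a b),
    vcomp (lunitInv A) (lunitHom A) (Category.comp_id _) (Category.comp_id _) = idCell _
  lunit_natural : ∀ {a b a' b' : D} {f : a ⟶ a'} {g : b ⟶ b'} {A : Pro a b} {A' : Pro a' b'}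
    (φ : Cell f g A A'),
    vcomp (hcomp (unitCell f) φ) (lunitHom A') (Category.comp_id f) (Category.comp_id g) =
      vcomp (lunitHom A) φ (Category.id_comp f) (Category.id_comp g)
  runitHom : ∀ {a b : D} (A : Pro a b), Cell (𝟙 a) (𝟙 b) (pcomp A (U b)) A
  runitInv : ∀ {a b : D} (A : Pro a b), Cell (𝟙 a) (𝟙 b) A (pcomp A (U b))
  runit_hom_inv : ∀ {a b : D} (A : Pro a b),
    vcomp (runitHom A) (runitInv A) (Category.comp_id _) (Category.comp_id _) = idCell _
  runit_inv_hom : ∀ {a b : D} (A : Pro a b),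
    vcomp (runitInv A) (runitHom A) (Category.comp_id _) (Category.comp_id _) = idCell _
  runit_natural : ∀ {a b a' b' : D} {f : a ⟶ a'} {g : b ⟶ b'} {A : Pro a b} {A' : Pro a' b'}
    (φ : Cell f g A A'),
    vcomp (hcomp φ (unitCell g)) (runitHom A') (Category.comp_id f) (Category.comp_id g) =
      vcomp (runitHom A) φ (Category.id_comp f) (Category.id_comp g)
  -- coherence
  pentagon : ∀ {a b c d e : D} (A : Pro a b) (B : Pro b c) (C : Pro c d) (E : Pro d e),
    vcomp (hcomp (assocHom A B C) (idCell E))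
        (vcomp (assocHom A (pcomp B C) E) (hcomp (idCell A) (assocHom B C E))
          (Category.comp_id _) (Category.comp_id _))
        (Category.comp_id _) (Category.comp_id _) =
      vcomp (assocHom (pcomp A B) C E) (assocHom A B (pcomp C E))
        (Category.comp_id _) (Category.comp_id _)
  triangle : ∀ {a b c : D} (A : Pro a b) (B : Pro b c),
    vcomp (assocHom A (U b) B) (hcomp (idCell A) (lunitHom B))
        (Category.comp_id _) (Category.comp_id _) =
      hcomp (runitHom A) (idCell B)

namespace DoubleCategory

section

variable (D : Type u) [DoubleCategory.{z, w, v} D]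

/-- The category of proarrows `a ⇸ b`, whose morphisms are the cells with identity frames. -/
instance proCategory (a b : D) : Category.{z} (Pro a b) where
  Hom A B := Cell (𝟙 a) (𝟙 b) A B
  id A := idCell A
  comp φ ψ := vcomp φ ψ (Category.comp_id _) (Category.comp_id _)
  id_comp φ := id_vcomp φ
  comp_id φ := vcomp_id φ
  assoc φ ψ χ := vcomp_assoc φ ψ χ _ _ _ _ _ _ _ _

variable {D}

/-- The associator as an isomorphism of proarrows. -/
def assocIso {a b c d : D} (A : Pro a b) (B : Pro b c) (C : Pro c d) :
    pcomp (pcomp A B) C ≅ pcomp A (pcomp B C) :=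
  ⟨assocHom A B C, assocInv A B C, assoc_hom_inv A B C, assoc_inv_hom A B C⟩

/-- The left unitor as an isomorphism of proarrows. -/
def lunitIso {a b : D} (A : Pro a b) : pcomp (U a) A ≅ A :=
  ⟨lunitHom A, lunitInv A, lunit_hom_inv A, lunit_inv_hom A⟩

/-- The right unitor as an isomorphism of proarrows. -/
def runitIso {a b : D} (A : Pro a b) : pcomp A (U b) ≅ A :=
  ⟨runitHom A, runitInv A, runit_hom_inv A, runit_inv_hom A⟩

/-- Horizontal composite of morphisms of proarrows. -/
def hmap {a b c : D} {A A' : Pro a b} {B B' : Pro b c} (φ : A ⟶ A') (ψ : B ⟶ B') :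
    pcomp A B ⟶ pcomp A' B' :=
  hcomp φ ψ

theorem hmap_id {a b c : D} (A : Pro a b) (B : Pro b c) :
    hmap (𝟙 A) (𝟙 B) = 𝟙 (pcomp A B) :=
  hcomp_id A B

theorem hmap_comp {a b c : D} {A A' A'' : Pro a b} {B B' B'' : Pro b c}
    (φ : A ⟶ A') (ψ : B ⟶ B') (φ' : A' ⟶ A'') (ψ' : B' ⟶ B'') :
    hmap (φ ≫ φ') (ψ ≫ ψ') = hmap φ ψ ≫ hmap φ' ψ' :=
  interchange φ ψ φ' ψ' _ _ _

theorem hmap_assoc {a b c d : D} {A A' : Pro a b} {B B' : Pro b c} {C C' : Pro c d}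
    (φ : A ⟶ A') (ψ : B ⟶ B') (χ : C ⟶ C') :
    hmap (hmap φ ψ) χ ≫ (assocIso A' B' C').hom =
      (assocIso A B C).hom ≫ hmap φ (hmap ψ χ) :=
  assoc_natural φ ψ χ

theorem hmap_lunit {a b : D} {A A' : Pro a b} (φ : A ⟶ A') :
    hmap (𝟙 (U a)) φ ≫ (lunitIso A').hom = (lunitIso A).hom ≫ φ := by
  have h := lunit_natural φ
  rw [unitCell_id] at h
  exact h

theorem hmap_runit {a b : D} {A A' : Pro a b} (φ : A ⟶ A') :
    hmap φ (𝟙 (U b)) ≫ (runitIso A').hom = (runitIso A).hom ≫ φ := by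
  have h := runit_natural φ
  rw [unitCell_id] at h
  exact h

variable (D)

/-- The objects of the horizontal bicategory of `D`: the objects of `D`. -/
structure Hor : Type u where
  /-- the underlying object of `D` -/
  obj : D

/-- The horizontal bicategory: its 1-cells are the proarrows, and its 2-cells are the cells
whose left and right frames are identities. -/
instance Hor.bicategory : Bicategory.{z, w} (Hor D) where
  Hom a b := Pro a.obj b.obj
  id a := U a.obj
  comp A B := pcomp A B
  homCategory a b := proCategory D a.obj b.obj
  whiskerLeft A _ _ φ := hmap (𝟙 A) φ
  whiskerRight φ B := hmap φ (𝟙 B)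
  associator A B C := assocIso A B C
  leftUnitor A := lunitIso A
  rightUnitor A := runitIso A
  whiskerLeft_id A B := hmap_id A B
  whiskerLeft_comp A _ _ _ φ ψ := by
    rw [← hmap_comp, Category.id_comp]
  id_whiskerLeft φ := by
    rw [← Category.assoc, Iso.eq_comp_inv]
    exact hmap_lunit φ
  comp_whiskerLeft A B _ _ φ := by
    rw [← Category.assoc, Iso.eq_comp_inv, ← hmap_id]
    exact hmap_assoc _ _ _
  id_whiskerRight A B := hmap_id A B
  comp_whiskerRight φ ψ B := by
    rw [← hmap_comp, Category.id_comp]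
  whiskerRight_id φ := by
    rw [← Category.assoc, Iso.eq_comp_inv]
    exact hmap_runit φ
  whiskerRight_comp φ B C := by
    rw [Iso.eq_inv_comp, ← hmap_id]
    exact (hmap_assoc _ _ _).symm
  whisker_assoc A _ _ φ C := by
    rw [← Category.assoc, Iso.eq_comp_inv]
    exact hmap_assoc _ _ _
  whisker_exchange φ ψ := by
    rw [← hmap_comp, ← hmap_comp, Category.id_comp, Category.comp_id, Category.id_comp,
      Category.comp_id]
  pentagon A B C E := pentagon A B C E
  triangle A B := triangle A B

variable {D}

/-- A cell `φ : P ⟶ Q` with frames `f`, `g` is cartesian if every cell into `Q` whose frames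
factor through `f` and `g` factors uniquely through `φ`. It exhibits `P` as the restriction
`Q(g, f)`. -/
def IsCartesian {a b a' b' : D} {f : a ⟶ a'} {g : b ⟶ b'} {P : Pro a b} {Q : Pro a' b'}
    (φ : Cell f g P Q) : Prop :=
  ∀ {x y : D} (h : x ⟶ a) (k : y ⟶ b) (R : Pro x y) (χ : Cell (h ≫ f) (k ≫ g) R Q),
    ∃! ψ : Cell h k R P, vcomp ψ φ rfl rfl = χ

variable (D) in
/-- An equipment (framed bicategory) is a double category with all restrictions. -/
def IsEquipment : Prop :=
  ∀ {a b a' b' : D} (f : a ⟶ a') (g : b ⟶ b') (Q : Pro a' b'),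
    ∃ (P : Pro a b) (φ : Cell f g P Q), IsCartesian φ

/-- Precomposition of a cell with a cell with identity frames. -/
abbrev pre {a b a' b' : D} {f : a ⟶ a'} {g : b ⟶ b'} {A A' : Pro a b} {B : Pro a' b'}
    (θ : A ⟶ A') (φ : Cell f g A' B) : Cell f g A B :=
  vcomp θ φ (Category.id_comp f) (Category.id_comp g)

/-- Postcomposition of a cell with a cell with identity frames. -/
abbrev post {a b a' b' : D} {f : a ⟶ a'} {g : b ⟶ b'} {A : Pro a b} {B B' : Pro a' b'}
    (φ : Cell f g A B) (θ : B ⟶ B') : Cell f g A B' :=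
  vcomp φ θ (Category.comp_id f) (Category.comp_id g)

/-! ## Monoids, bimodules, embeddings -/

/-- A monoid in `D` on the object `c`, i.e. a monad in the horizontal bicategory. -/
abbrev Mon (c : D) := Bicategory.Mnd (B := Hor D) ⟨c⟩

/-- The underlying proarrow of a monoid. -/
abbrev Mon.pro {c : D} (M : Mon c) : Pro c c := M.t

/-- A bimodule from the monoid `M` on `c` to the monoid `N` on `d`. -/
abbrev Bimod {c d : D} (M : Mon c) (N : Mon d) := Bicategory.Bimodule (B := Hor D) M N

/-- The underlying proarrow of a bimodule. -/
abbrev Bimod.pro {c d : D} {M : Mon c} {N : Mon d} (B : Bimod M N) : Pro c d := B.X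

/-- An embedding of the monoid `M` into the object `x` with underlying vertical arrow `f`: a cell
`M ⟶ U x` with both frames `f` which respects the units and multiplications of `M` and of the
trivial monoid `U x`. -/
structure Embedding {c x : D} (M : Mon c) (f : c ⟶ x) where
  cell : Cell f f (Mon.pro M) (U x)
  unit : pre M.η cell = unitCell f
  mul : pre M.μ cell = post (hcomp cell cell) (lunitHom (U x))

/-- The cell `φ : B ⟶ P` is an embedding of the bimodule `B` into the proarrow `P`, along the
monoid embeddings `F` and `G`: it respects the left and right actions, where the trivial monoids
on `x` and `y` act on `P` through the unitors. -/
structure IsBimodEmbedding {c d x y : D} {M : Mon c} {N : Mon d} {f : c ⟶ x} {g : d ⟶ y}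
    (F : Embedding M f) (G : Embedding N g) (B : Bimod M N) {P : Pro x y}
    (φ : Cell f g (Bimod.pro B) P) : Prop where
  left : pre B.l φ = post (hcomp F.cell φ) (lunitHom P)
  right : pre B.r φ = post (hcomp φ G.cell) (runitHom P)

/-! ## Collapse -/

/-- The embedding `F` factors through the embedding `I` via the vertical arrow `h`. -/
def Embedding.Factors {c q x : D} {M : Mon c} {i : c ⟶ q} {f : c ⟶ x}
    (I : Embedding M i) (F : Embedding M f) (h : q ⟶ x) : Prop :=
  ∃ e : i ≫ h = f, vcomp I.cell (unitCell h) e e = F.cell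

/-- A collapse of `M`: an embedding through which every embedding factors uniquely. -/
def Embedding.IsCollapse {c q : D} {M : Mon c} {i : c ⟶ q} (I : Embedding M i) : Prop :=
  ∀ {x : D} {f : c ⟶ x} (F : Embedding M f), ∃! h : q ⟶ x, I.Factors F h

/-- A collapse of the bimodule `B`: an embedding `φ` of `B` along collapses `I` of `M` and `J` of
`N`, such that every embedding `χ` of `B` into some `Q`, along embeddings `F = h ∘ I` and
`G = k ∘ J`, factors through `φ` via a unique cell with frames `h` and `k`. -/
structure IsBimodCollapse {c d q r : D} {M : Mon c} {N : Mon d} {i : c ⟶ q} {j : d ⟶ r}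
    (I : Embedding M i) (J : Embedding N j) (B : Bimod M N) {P : Pro q r}
    (φ : Cell i j (Bimod.pro B) P) : Prop where
  collapse_left : I.IsCollapse
  collapse_right : J.IsCollapse
  embedding : IsBimodEmbedding I J B φ
  universal : ∀ {x y : D} {f : c ⟶ x} {g : d ⟶ y} (F : Embedding M f) (G : Embedding N g)
    {Q : Pro x y} (χ : Cell f g (Bimod.pro B) Q), IsBimodEmbedding F G B χ →
    ∀ (h : q ⟶ x) (k : r ⟶ y) (hF : I.Factors F h) (hG : J.Factors G k),
      ∃! ψ : Cell h k P Q, vcomp φ ψ hF.1 hG.1 = χ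

/-- A normal collapse: a collapse of `M` whose cell is also a bimodule collapse of the unit
bimodule of `M`. -/
def Embedding.IsNormalCollapse {c q : D} {M : Mon c} {i : c ⟶ q} (I : Embedding M i) : Prop :=
  I.IsCollapse ∧ IsBimodCollapse I I (Bicategory.Bimodule.unit M) (P := U q) I.cell

/-! ## Regular and exact equipments -/

/-- The embedding `F` exhibits `M` as the kernel of `f`, i.e. as the restriction along `f` of the
trivial monoid on `x`. -/
def Embedding.IsKernel {c x : D} {M : Mon c} {f : c ⟶ x} (F : Embedding M f) : Prop :=
  IsCartesian F.cell

/-- `M` is effective if it is the kernel of some vertical arrow. -/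
def MonEffective {c : D} (M : Mon c) : Prop :=
  ∃ (x : D) (f : c ⟶ x) (F : Embedding M f), F.IsKernel

/-- `B` is effective if its monoids are kernels of vertical arrows `f` and `g`, and `B` is the
restriction along `f` and `g` of some proarrow; i.e. if it has a cartesian embedding. -/
def BimodEffective {c d : D} {M : Mon c} {N : Mon d} (B : Bimod M N) : Prop :=
  ∃ (x y : D) (f : c ⟶ x) (g : d ⟶ y) (F : Embedding M f) (G : Embedding N g)
    (P : Pro x y) (φ : Cell f g (Bimod.pro B) P),
    F.IsKernel ∧ G.IsKernel ∧ IsBimodEmbedding F G B φ ∧ IsCartesian φ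

/-- `f` is a regular cover if the cartesian cell from its kernel is a normal collapse. -/
def IsRegularCover {c d : D} (f : c ⟶ d) : Prop :=
  ∃ (K : Mon c) (F : Embedding K f), F.IsKernel ∧ F.IsNormalCollapse

variable (D) in
/-- Regular equipments. -/
structure IsRegular : Prop where
  /-- every effective monoid has a normal collapse -/
  collapse : ∀ {c : D} (M : Mon c), MonEffective M →
    ∃ (q : D) (i : c ⟶ q) (I : Embedding M i), I.IsNormalCollapse
  /-- for regular covers `f`, `g` and a proarrow `B`, the cartesian embedding of the
  `(ker f, ker g)`-bimodule `B(g, f)` into `B` is a bimodule collapse -/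
  bimodCollapse : ∀ {c d c' d' : D} (f : c ⟶ d) (g : c' ⟶ d'),
    IsRegularCover f → IsRegularCover g → ∀ (B : Pro d d')
    {K : Mon c} {L : Mon c'} (F : Embedding K f) (G : Embedding L g),
    F.IsKernel → G.IsKernel → ∀ (R : Bimod K L) (φ : Cell f g (Bimod.pro R) B),
    IsBimodEmbedding F G R φ → IsCartesian φ → IsBimodCollapse F G R φ

variable (D) in
/-- Exact equipments: regular, and every monoid and every bimodule is effective. -/
structure IsExact : Prop where
  regular : IsRegular D
  monEffective : ∀ {c : D} (M : Mon c), MonEffective M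
  bimodEffective : ∀ {c d : D} {M : Mon c} {N : Mon d} (B : Bimod M N), BimodEffective B

/-! ## Wood's axiom 5 -/

/-- The cell `ξ : P ⟶ U d` with frames `f` and the identity represents `P` by `f`, i.e. exhibits
`P` as `d(1, f)`. -/
def Represents {c d : D} {P : Pro c d} {f : c ⟶ d} (ξ : Cell f (𝟙 d) P (U d)) : Prop :=
  IsCartesian ξ

/-- The proarrow `P : c ⇸ d` is representable. -/
def IsRepresentable {c d : D} (P : Pro c d) : Prop :=
  ∃ (f : c ⟶ d) (ξ : Cell f (𝟙 d) P (U d)), Represents ξ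

/-- For a cell `ι : I ⟶ U q` with frames `i` and the identity, the induced cell `I ⊙ P ⟶ P` with
the same frames. -/
def restrictCell {c q d : D} {i : c ⟶ q} {I : Pro c q} (ι : Cell i (𝟙 q) I (U q)) (P : Pro q d) :
    Cell i (𝟙 d) (pcomp I P) P :=
  post (hcomp ι (idCell P)) (lunitHom P)

variable (D) in
/-- Wood's axiom 5 (strict form). For every monoid `M` on `c` there are an object `q`, a vertical
arrow `i : c ⟶ q` and a cell `ι : M ⟶ U q` with frames `i`, together with representing cells
`α : I ⟶ U q` of `I = q(1, i)` and `β : J ⟶ U q` of `J = q(i, 1)`, where `I = L.X` and `J = R.X`,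
such that
* the cell `M ⊙ I ⟶ I` corresponding to `ι` makes `I` a universal left `M`-module,
* the cell `J ⊙ M ⟶ J` corresponding to `ι` makes `J` a universal right `M`-module,
* a proarrow `P : q ⇸ d` is representable iff `I ⊙ P` is; and if `ξ` represents `I ⊙ P` by
  `g : c ⟶ d`, there is a unique `f : q ⟶ d` with `f ∘ i = g` such that `P` is represented by `f`
  compatibly with `ξ`. -/
def WoodAxiom5 : Prop :=
  ∀ {c : D} (M : Mon c), ∃ (q : D) (i : c ⟶ q) (ι : Cell i i (Mon.pro M) (U q))
    (L : Bicategory.LMod (B := Hor D) M ⟨q⟩) (α : Cell i (𝟙 q) L.X (U q))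
    (R : Bicategory.RMod (B := Hor D) M ⟨q⟩) (β : Cell (𝟙 q) i R.X (U q)),
    IsCartesian α ∧ IsCartesian β ∧
    pre L.act α = post (hcomp ι α) (lunitHom (U q)) ∧
    pre R.act β = post (hcomp β ι) (lunitHom (U q)) ∧
    L.IsUniversal ∧
    R.IsUniversal ∧
    (∀ {d : D} (P : Pro q d), IsRepresentable P ↔ IsRepresentable (pcomp (D := D) L.X P)) ∧
    (∀ {d : D} (P : Pro q d) (g : c ⟶ d) (ξ : Cell g (𝟙 d) (pcomp (D := D) L.X P) (U d)),
      Represents ξ →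
      ∃! f : q ⟶ d, ∃ (e : i ≫ f = g) (ψ : Cell f (𝟙 d) P (U d)),
        Represents ψ ∧ vcomp (restrictCell α P) ψ e (Category.comp_id (𝟙 d)) = ξ)

end

end DoubleCategory

/-! Both conditions are compared through one notion about a cell `ι : M ⟶ U q` with frames `i`. Call
a cell from a left `M`-module a left embedding if it respects the action along `ι` (`IsLEmb`).
`LUniv ι` says that every left `M`-module is a restriction `Y(1, i)` by a cartesian left embedding,
and that such embeddings are universal. The canonical cell `q(1, i) ⊙ Y ⟶ Y` is cartesian
(`isCartesian_lc_companion`), so module maps into `q(1, i) ⊙ Y` are the same as left embeddings into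
`Y`. Hence `LUniv ι` holds exactly when `q(1, i)` is a universal left module, and `RUniv` plays the
same role for `q(i, 1)`.

Exact implies Wood. Take a normal collapse `I` of `M` along `i`. The main point is
`IsExact.isKernel`: effectiveness of the module `q(1, i)`, together with normality, makes `I` a
kernel, so `i` is a regular cover. The second exactness axiom for the pairs `(i, 1)` and `(1, i)`,
together with effectiveness of one-sided modules, then gives `LUniv` and `RUniv`. For the
representability clause, an action of `M` on a proarrow represented by `g` is the same thing as an
embedding of `M` along `g` (`LAct.embedding`), and a collapse factors it. Restriction along `i`
reflects cartesian cells (`LUniv.isCartesian_of_restrict`), so the factorization represents `P`.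

Wood implies exact. The same dictionary turns the representability clause into the collapse property
(`LUniv.isCollapse`). `M` as a left module over itself descends to the conjoint `q(i, 1)`, because a
left embedding of `M` is determined by its value at the unit; this makes `ι` a kernel
(`LUniv.isKernel`). Bimodules are treated one side at a time: the right action descends along the
left quotient, and then `RUniv` applies (`exists_bimod_cartesian`, `bimod_existsUnique`). Uniqueness
of collapses up to isomorphism carries the result from Wood's objects to arbitrary collapses. -/

namespace DoubleCategory

variable {D : Type u} [DoubleCategory.{z, w, v} D]

/-! ## Calculus of vertical composites -/

section Vertical

variable {a b a' b' a'' b'' a₃ b₃ : D} {f : a ⟶ a'} {g : b ⟶ b'} {f' : a' ⟶ a''} {g' : b' ⟶ b''}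
  {f'' : a'' ⟶ a₃} {g'' : b'' ⟶ b₃}
  {A : Pro a b} {A' : Pro a' b'} {A'' : Pro a'' b''} {A₃ : Pro a₃ b₃}

/-- Right-normalising form of associativity. -/
theorem vassoc {f₁₂ : a ⟶ a''} {g₁₂ : b ⟶ b''} {h : a ⟶ a₃} {k : b ⟶ b₃}
    (φ₁ : Cell f g A A') (φ₂ : Cell f' g' A' A'') (φ₃ : Cell f'' g'' A'' A₃)
    (p₁₂ : f ≫ f' = f₁₂) (q₁₂ : g ≫ g' = g₁₂) (p : f₁₂ ≫ f'' = h) (q : g₁₂ ≫ g'' = k) :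
    vcomp (vcomp φ₁ φ₂ p₁₂ q₁₂) φ₃ p q =
      vcomp φ₁ (vcomp φ₂ φ₃ rfl rfl) (by rw [← p, ← p₁₂, Category.assoc])
        (by rw [← q, ← q₁₂, Category.assoc]) :=
  vcomp_assoc ..

/-- Associativity with prescribed inner frames. -/
theorem vassoc' {f₁₂ : a ⟶ a''} {g₁₂ : b ⟶ b''} {h : a ⟶ a₃} {k : b ⟶ b₃}
    {s : a' ⟶ a₃} {t : b' ⟶ b₃}
    (p₂₃ : f' ≫ f'' = s) (q₂₃ : g' ≫ g'' = t)
    (φ₁ : Cell f g A A') (φ₂ : Cell f' g' A' A'') (φ₃ : Cell f'' g'' A'' A₃)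
    (p₁₂ : f ≫ f' = f₁₂) (q₁₂ : g ≫ g' = g₁₂) (p : f₁₂ ≫ f'' = h) (q : g₁₂ ≫ g'' = k) :
    vcomp (vcomp φ₁ φ₂ p₁₂ q₁₂) φ₃ p q =
      vcomp φ₁ (vcomp φ₂ φ₃ p₂₃ q₂₃) (by rw [← p, ← p₁₂, ← p₂₃, Category.assoc])
        (by rw [← q, ← q₁₂, ← q₂₃, Category.assoc]) :=
  vcomp_assoc ..

/-- Rewriting a composite of two cells at the head of a longer composite. -/
theorem vreassoc {h : a ⟶ a''} {k : b ⟶ b''} {s : a' ⟶ a₃} {t : b' ⟶ b₃}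
    {s' : a ⟶ a₃} {t' : b ⟶ b₃}
    {φ₁ : Cell f g A A'} {φ₂ : Cell f' g' A' A''} {p : f ≫ f' = h} {q : g ≫ g' = k}
    {χ : Cell h k A A''} (e : vcomp φ₁ φ₂ p q = χ) (φ₃ : Cell f'' g'' A'' A₃)
    (p₁ : f' ≫ f'' = s) (q₁ : g' ≫ g'' = t) (p₂ : f ≫ s = s') (q₂ : g ≫ t = t') :
    vcomp φ₁ (vcomp φ₂ φ₃ p₁ q₁) p₂ q₂ =
      vcomp χ φ₃ (by rw [← p₂, ← p₁, ← p, Category.assoc])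
        (by rw [← q₂, ← q₁, ← q, Category.assoc]) := by
  subst e
  exact (vcomp_assoc ..).symm

theorem vcomp_unitCell_id {x : D} {f : a ⟶ x} {g : b ⟶ x} (φ : Cell f g A (U x))
    (p : f ≫ 𝟙 x = f) (q : g ≫ 𝟙 x = g) : vcomp φ (unitCell (𝟙 x)) p q = φ := by
  rw [unitCell_id]; exact vcomp_id φ

theorem unitCell_comp' {x y t : D} (f : x ⟶ y) (g : y ⟶ t) {h : x ⟶ t} (p q : f ≫ g = h) :
    vcomp (unitCell f) (unitCell g) p q = unitCell h := by
  subst p; exact (unitCell_comp f g).symm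

theorem assocInv_cancel {x c d e : D} {A : Pro x c} {B : Pro c d} {C : Pro d e} {x' e' : D}
    {s : x ⟶ x'} {t : e ⟶ e'} {R : Pro x' e'} {φ ψ : Cell s t (pcomp A (pcomp B C)) R}
    (h : vcomp (assocHom A B C) φ (Category.id_comp s) (Category.id_comp t) =
      vcomp (assocHom A B C) ψ (Category.id_comp s) (Category.id_comp t)) : φ = ψ := by
  have key : ∀ φ : Cell s t (pcomp A (pcomp B C)) R, vcomp (assocInv A B C)
      (vcomp (assocHom A B C) φ (Category.id_comp s) (Category.id_comp t))
      (Category.id_comp s) (Category.id_comp t) = φ := fun φ => by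
    rw [vreassoc (assoc_inv_hom A B C), id_vcomp]
  rw [← key φ, h, key]

theorem lunit_cancel {x c x' c' : D} {A : Pro x c} {s : x ⟶ x'} {t : c ⟶ c'} {R : Pro x' c'}
    {φ ψ : Cell s t A R}
    (h : vcomp (lunitHom A) φ (Category.id_comp s) (Category.id_comp t) =
      vcomp (lunitHom A) ψ (Category.id_comp s) (Category.id_comp t)) : φ = ψ := by
  have key : ∀ φ : Cell s t A R, vcomp (lunitInv A)
      (vcomp (lunitHom A) φ (Category.id_comp s) (Category.id_comp t))
      (Category.id_comp s) (Category.id_comp t) = φ := fun φ => by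
    rw [vreassoc (lunit_inv_hom A), id_vcomp]
  rw [← key φ, h, key]

theorem runit_cancel {x c x' c' : D} {A : Pro x c} {s : x ⟶ x'} {t : c ⟶ c'} {R : Pro x' c'}
    {φ ψ : Cell s t A R}
    (h : vcomp (runitHom A) φ (Category.id_comp s) (Category.id_comp t) =
      vcomp (runitHom A) ψ (Category.id_comp s) (Category.id_comp t)) : φ = ψ := by
  have key : ∀ φ : Cell s t A R, vcomp (runitInv A)
      (vcomp (runitHom A) φ (Category.id_comp s) (Category.id_comp t))
      (Category.id_comp s) (Category.id_comp t) = φ := fun φ => by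
    rw [vreassoc (runit_inv_hom A), id_vcomp]
  rw [← key φ, h, key]

end Vertical

/-! ## Composites with cells into units -/

section Act

open Bicategory

/-- Coherence consequences are taken from the bicategory `Hor D`, whose associators and unitors are
by definition those of `D`. The next two lemmas are obtained in the same way. -/
theorem lunit_U (x : D) : lunitHom (U x) = runitHom (U x) := by
  have h : ∀ a : Hor D, (λ_ (𝟙 a)).hom = (ρ_ (𝟙 a)).hom := fun a => by rw [unitors_equal]
  exact h ⟨x⟩

theorem lunit_pcomp {x y t : D} (A : Pro x y) (B : Pro y t) :
    vcomp (assocHom (U x) A B) (lunitHom (pcomp A B)) (Category.comp_id _) (Category.comp_id _) =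
      hcomp (lunitHom A) (idCell B) := by
  have h : ∀ {a b c : Hor D} (A : a ⟶ b) (B : b ⟶ c),
      (α_ (𝟙 a) A B).hom ≫ (λ_ (A ≫ B)).hom = (λ_ A).hom ▷ B := by
    intro a b c A B; simp
  exact @h ⟨x⟩ ⟨y⟩ ⟨t⟩ A B

theorem runit_pcomp {x y t : D} (A : Pro x y) (B : Pro y t) :
    vcomp (assocHom A B (U t)) (hcomp (idCell A) (runitHom B)) (Category.comp_id _)
      (Category.comp_id _) = runitHom (pcomp A B) := by
  have h : ∀ {a b c : Hor D} (A : a ⟶ b) (B : b ⟶ c),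
      (α_ A B (𝟙 c)).hom ≫ (A ◁ (ρ_ B).hom) = (ρ_ (A ≫ B)).hom := by
    intro a b c A B; simp
  exact @h ⟨x⟩ ⟨y⟩ ⟨t⟩ A B

variable {a b c d a' b' c' x y t : D}

/-- Horizontal composite with a cell into a unit on the left, with the unit absorbed. -/
def lc {f : a ⟶ x} {g : b ⟶ x} {h : c ⟶ y} {A : Pro a b} {B : Pro b c} {P : Pro x y}
    (φ : Cell f g A (U x)) (ψ : Cell g h B P) : Cell f h (pcomp A B) P :=
  post (hcomp φ ψ) (lunitHom P)

/-- Horizontal composite with a cell into a unit on the right, with the unit absorbed. -/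
def rc {f : a ⟶ x} {g : b ⟶ y} {h : c ⟶ y} {A : Pro a b} {B : Pro b c} {P : Pro x y}
    (ψ : Cell f g A P) (φ : Cell g h B (U y)) : Cell f h (pcomp A B) P :=
  post (hcomp ψ φ) (runitHom P)

/-- The two unitors of `U x` agree. This is why multiplicativity of a monoid embedding is at once a
left and a right action law. -/
theorem lc_eq_rc {f : a ⟶ x} {g : b ⟶ x} {h : c ⟶ x} {A : Pro a b} {B : Pro b c}
    (φ : Cell f g A (U x)) (ψ : Cell g h B (U x)) : lc φ ψ = rc φ ψ := by
  rw [lc, rc, post, post, lunit_U]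

theorem pre_lc {f : a ⟶ x} {g : b ⟶ x} {h : c ⟶ y} {A : Pro a b} {B : Pro b c} {P : Pro x y}
    {f' : a' ⟶ a} {g' : b' ⟶ b} {h' : c' ⟶ c} {A' : Pro a' b'} {B' : Pro b' c'}
    {ff : a' ⟶ x} {gg : b' ⟶ x} {hh : c' ⟶ y}
    (θ : Cell f' g' A' A) (θ' : Cell g' h' B' B)
    (φ : Cell f g A (U x)) (ψ : Cell g h B P) (p : f' ≫ f = ff) (r : h' ≫ h = hh)
    (q : g' ≫ g = gg) :
    vcomp (hcomp θ θ') (lc φ ψ) p r = lc (vcomp θ φ p q) (vcomp θ' ψ q r) := by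
  subst p q r
  rw [lc, lc, post, post, interchange (q := rfl), vassoc]
  rw [vreassoc (p := rfl) (q := rfl) rfl, vassoc]

/-- Naturality of the left unitor: a cell `χ` with left frame `s` is seen by the factor landing in
`U x` only through `unitCell s`. -/
theorem lc_post {f : a ⟶ x} {g : b ⟶ x} {h : c ⟶ y} {A : Pro a b} {B : Pro b c} {P : Pro x y}
    {x' y' : D} {s : x ⟶ x'} {r : y ⟶ y'} {Q : Pro x' y'}
    {fs : a ⟶ x'} {gs : b ⟶ x'} {hr : c ⟶ y'}
    (φ : Cell f g A (U x)) (ψ : Cell g h B P) (χ : Cell s r P Q) (p : f ≫ s = fs) (k : h ≫ r = hr)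
    (q : g ≫ s = gs) :
    vcomp (lc φ ψ) χ p k = lc (vcomp φ (unitCell s) p q) (vcomp ψ χ q k) := by
  subst p q k
  rw [lc, lc, post, post, interchange (q := rfl),
    vassoc' (Category.id_comp s) (Category.id_comp r), ← lunit_natural,
    vassoc' (Category.comp_id s) (Category.comp_id r)]

/-- Both sides are brought to `φ ⊙ ψ ⊙ χ` followed by unitors on `U x ⊙ U x ⊙ P`, where the triangle
identity and `lunit_U` compare them. -/
theorem lc_assoc {f : a ⟶ x} {g : b ⟶ x} {h : c ⟶ x} {k : d ⟶ y}
    {A : Pro a b} {B : Pro b c} {C : Pro c d} {P : Pro x y}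
    (φ : Cell f g A (U x)) (ψ : Cell g h B (U x)) (χ : Cell h k C P) :
    vcomp (assocHom A B C) (lc φ (lc ψ χ)) (Category.id_comp f) (Category.id_comp k) =
      lc (lc φ ψ) χ := by
  have e₁ : lc φ (lc ψ χ) = vcomp (hcomp φ (hcomp ψ χ))
      (vcomp (hcomp (idCell (U x)) (lunitHom P)) (lunitHom P) (Category.comp_id _)
        (Category.comp_id _)) (Category.comp_id _) (Category.comp_id _) := by
    rw [lc, lc, post, post, ← vcomp_id φ, interchange (q := Category.comp_id g), vcomp_id,
      vassoc' (Category.comp_id _) (Category.comp_id _)]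
  have e₂ : lc (lc φ ψ) χ = vcomp (hcomp (hcomp φ ψ) χ)
      (vcomp (hcomp (lunitHom (U x)) (idCell P)) (lunitHom P) (Category.comp_id _)
        (Category.comp_id _)) (Category.comp_id _) (Category.comp_id _) := by
    rw [lc, lc, post, post, ← vcomp_id χ, interchange (q := Category.comp_id h), vcomp_id,
      vassoc' (Category.comp_id _) (Category.comp_id _)]
  rw [e₁, e₂, vreassoc (assoc_natural φ ψ χ).symm, lunit_U, ← triangle,
    vassoc' (Category.comp_id _) (Category.comp_id _),
    vassoc' (Category.comp_id _) (Category.comp_id _)]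

theorem rc_assoc {f : a ⟶ x} {g : b ⟶ y} {h : c ⟶ y} {k : d ⟶ y}
    {A : Pro a b} {B : Pro b c} {C : Pro c d} {P : Pro x y}
    (φ : Cell f g A P) (ψ : Cell g h B (U y)) (χ : Cell h k C (U y)) :
    vcomp (assocHom A B C) (rc φ (lc ψ χ)) (Category.id_comp f) (Category.id_comp k) =
      rc (rc φ ψ) χ := by
  have e₁ : rc φ (lc ψ χ) = vcomp (hcomp φ (hcomp ψ χ))
      (vcomp (hcomp (idCell P) (lunitHom (U y))) (runitHom P) (Category.comp_id _)
        (Category.comp_id _)) (Category.comp_id _) (Category.comp_id _) := by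
    rw [lc, rc, post, post, ← vcomp_id φ, interchange (q := Category.comp_id g), vcomp_id,
      vassoc' (Category.comp_id _) (Category.comp_id _)]
  have e₂ : rc (rc φ ψ) χ = vcomp (hcomp (hcomp φ ψ) χ)
      (vcomp (hcomp (runitHom P) (idCell (U y))) (runitHom P) (Category.comp_id _)
        (Category.comp_id _)) (Category.comp_id _) (Category.comp_id _) := by
    rw [rc, rc, post, post, ← vcomp_id χ, interchange (q := Category.comp_id h), vcomp_id,
      vassoc' (Category.comp_id _) (Category.comp_id _)]
  rw [e₁, e₂, vreassoc (assoc_natural φ ψ χ).symm, ← triangle,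
    vassoc' (Category.comp_id _) (Category.comp_id _),
    vassoc' (Category.comp_id _) (Category.comp_id _)]

theorem lc_unitCell {f : b ⟶ x} {h : c ⟶ y} {B : Pro b c} {P : Pro x y} (ψ : Cell f h B P) :
    lc (unitCell f) ψ = vcomp (lunitHom B) ψ (Category.id_comp f) (Category.id_comp h) :=
  lunit_natural ψ

theorem rc_unitCell {f : b ⟶ x} {h : c ⟶ y} {B : Pro b c} {P : Pro x y} (ψ : Cell f h B P) :
    rc ψ (unitCell h) = vcomp (runitHom B) ψ (Category.id_comp f) (Category.id_comp h) :=
  runit_natural ψ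

theorem lc_unitCell_right {f : b ⟶ x} {h : c ⟶ x} {B : Pro b c} (ψ : Cell f h B (U x)) :
    lc ψ (unitCell h) = vcomp (runitHom B) ψ (Category.id_comp f) (Category.id_comp h) := by
  rw [lc_eq_rc, rc_unitCell]

theorem pre_rc {f : a ⟶ x} {g : b ⟶ y} {h : c ⟶ y} {A : Pro a b} {B : Pro b c} {P : Pro x y}
    {f' : a' ⟶ a} {g' : b' ⟶ b} {h' : c' ⟶ c} {A' : Pro a' b'} {B' : Pro b' c'}
    {ff : a' ⟶ x} {gg : b' ⟶ y} {hh : c' ⟶ y}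
    (θ : Cell f' g' A' A) (θ' : Cell g' h' B' B)
    (φ : Cell f g A P) (ψ : Cell g h B (U y)) (p : f' ≫ f = ff) (r : h' ≫ h = hh)
    (q : g' ≫ g = gg) :
    vcomp (hcomp θ θ') (rc φ ψ) p r = rc (vcomp θ φ p q) (vcomp θ' ψ q r) := by
  subst p q r
  rw [rc, rc, post, post, interchange (q := rfl), vassoc]
  rw [vreassoc (p := rfl) (q := rfl) rfl, vassoc]

theorem rc_post {f : a ⟶ x} {g : b ⟶ y} {h : c ⟶ y} {A : Pro a b} {B : Pro b c} {P : Pro x y}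
    {x' y' : D} {s : x ⟶ x'} {r : y ⟶ y'} {Q : Pro x' y'}
    {fs : a ⟶ x'} {gs : b ⟶ y'} {hr : c ⟶ y'}
    (φ : Cell f g A P) (ψ : Cell g h B (U y)) (χ : Cell s r P Q) (p : f ≫ s = fs) (k : h ≫ r = hr)
    (q : g ≫ r = gs) :
    vcomp (rc φ ψ) χ p k = rc (vcomp φ χ p q) (vcomp ψ (unitCell r) q k) := by
  subst p q k
  rw [rc, rc, post, post, interchange (q := rfl),
    vassoc' (Category.id_comp s) (Category.id_comp r), ← runit_natural,
    vassoc' (Category.comp_id s) (Category.comp_id r)]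

end Act

/-! ## Cartesian cells -/

section Cartesian

variable {a b a' b' a'' b'' : D} {f : a ⟶ a'} {g : b ⟶ b'} {P : Pro a b} {Q : Pro a' b'}

theorem IsCartesian.existsUnique {φ : Cell f g P Q} (hφ : IsCartesian φ) {x y : D} {h : x ⟶ a}
    {k : y ⟶ b} {s : x ⟶ a'} {t : y ⟶ b'} {R : Pro x y} (χ : Cell s t R Q)
    (p : h ≫ f = s) (q : k ≫ g = t) : ∃! ψ : Cell h k R P, vcomp ψ φ p q = χ := by
  subst p q; exact hφ h k R χ

theorem IsCartesian.of_existsUnique {φ : Cell f g P Q}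
    (hφ : ∀ {x y : D} {h : x ⟶ a} {k : y ⟶ b} {s : x ⟶ a'} {t : y ⟶ b'} {R : Pro x y}
      (χ : Cell s t R Q) (p : h ≫ f = s) (q : k ≫ g = t),
      ∃! ψ : Cell h k R P, vcomp ψ φ p q = χ) : IsCartesian φ :=
  fun _ _ _ χ => hφ χ rfl rfl

theorem IsCartesian.exists_lift {φ : Cell f g P Q} (hφ : IsCartesian φ) {x y : D} {h : x ⟶ a}
    {k : y ⟶ b} {s : x ⟶ a'} {t : y ⟶ b'} {R : Pro x y} (χ : Cell s t R Q)
    (p : h ≫ f = s) (q : k ≫ g = t) : ∃ ψ : Cell h k R P, vcomp ψ φ p q = χ :=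
  (hφ.existsUnique χ p q).exists

theorem IsCartesian.hom_ext {φ : Cell f g P Q} (hφ : IsCartesian φ) {x y : D} {h : x ⟶ a}
    {k : y ⟶ b} {s : x ⟶ a'} {t : y ⟶ b'} {R : Pro x y} {ψ ψ' : Cell h k R P}
    {p : h ≫ f = s} {q : k ≫ g = t} (e : vcomp ψ φ p q = vcomp ψ' φ p q) : ψ = ψ' :=
  (hφ.existsUnique (vcomp ψ' φ p q) p q).unique e rfl

variable {f' : a' ⟶ a''} {g' : b' ⟶ b''} {T : Pro a'' b''}

theorem IsCartesian.comp {φ : Cell f g P Q} {ψ : Cell f' g' Q T} (hφ : IsCartesian φ)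
    (hψ : IsCartesian ψ) {h : a ⟶ a''} {k : b ⟶ b''} (p : f ≫ f' = h) (q : g ≫ g' = k) :
    IsCartesian (vcomp φ ψ p q) := by
  subst p q
  intro x y h k R χ
  obtain ⟨χ₁, e₁⟩ := hψ.exists_lift (h := h ≫ f) (k := k ≫ g) χ (Category.assoc ..)
    (Category.assoc ..)
  obtain ⟨χ₂, e₂⟩ := hφ.exists_lift (h := h) (k := k) χ₁ rfl rfl
  refine ⟨χ₂, ?_, fun χ' e => ?_⟩
  · simp only
    rw [vreassoc e₂, e₁]
  · simp only at e
    rw [vreassoc (p := rfl) (q := rfl) rfl, ← e₁] at e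
    exact hφ.hom_ext ((hψ.hom_ext e).trans e₂.symm)

theorem IsCartesian.of_comp {φ : Cell f g P Q} {ψ : Cell f' g' Q T} (hψ : IsCartesian ψ)
    {h : a ⟶ a''} {k : b ⟶ b''} {p : f ≫ f' = h} {q : g ≫ g' = k}
    (hφ : IsCartesian (vcomp φ ψ p q)) : IsCartesian φ := by
  subst p q
  intro x y h k R χ
  obtain ⟨χ₁, e₁⟩ := hφ.exists_lift (h := h) (k := k) (vcomp χ ψ rfl rfl)
    (Category.assoc ..).symm (Category.assoc ..).symm
  rw [vreassoc (p := rfl) (q := rfl) rfl] at e₁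
  refine ⟨χ₁, hψ.hom_ext e₁, fun χ' e => ?_⟩
  refine hφ.hom_ext (p := rfl) (q := rfl) ?_
  rw [vreassoc (p := rfl) (q := rfl) e, vreassoc (p := rfl) (q := rfl) (hψ.hom_ext e₁)]

theorem isCartesian_of_isIso {P' : Pro a b} (θ : P ⟶ P') [IsIso θ] :
    IsCartesian (f := 𝟙 a) (g := 𝟙 b) θ := by
  intro x y h k R χ
  have e₁ : vcomp θ (inv θ) (Category.comp_id _) (Category.comp_id _) = idCell P :=
    IsIso.hom_inv_id θ
  have e₂ : vcomp (inv θ) θ (Category.comp_id _) (Category.comp_id _) = idCell P' :=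
    IsIso.inv_hom_id θ
  refine ⟨vcomp χ (inv θ) (by simp) (by simp), ?_, fun ψ e => ?_⟩
  · simp only
    rw [vassoc' (Category.comp_id _) (Category.comp_id _), e₂]
    exact vcomp_id χ
  · subst e
    rw [vassoc' (Category.comp_id _) (Category.comp_id _), e₁]
    exact (vcomp_id ψ).symm

/-- Cartesian cells with the same frames and target differ by an isomorphism. -/
theorem IsCartesian.exists_iso {P' : Pro a b} {φ : Cell f g P Q} {φ' : Cell f g P' Q}
    (hφ : IsCartesian φ) (hφ' : IsCartesian φ') : ∃ e : P ≅ P', pre e.hom φ' = φ := by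
  obtain ⟨s, hs⟩ := hφ'.exists_lift φ (Category.id_comp f) (Category.id_comp g)
  obtain ⟨t, ht⟩ := hφ.exists_lift φ' (Category.id_comp f) (Category.id_comp g)
  refine ⟨⟨s, t, ?_, ?_⟩, hs⟩
  · refine hφ.hom_ext (p := Category.id_comp f) (q := Category.id_comp g) ?_
    change vcomp (vcomp s t _ _) φ _ _ = vcomp (idCell P) φ _ _
    rw [vassoc' (Category.id_comp f) (Category.id_comp g), ht, hs, id_vcomp]
  · refine hφ'.hom_ext (p := Category.id_comp f) (q := Category.id_comp g) ?_
    change vcomp (vcomp t s _ _) φ' _ _ = vcomp (idCell P') φ' _ _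
    rw [vassoc' (Category.id_comp f) (Category.id_comp g), hs, ht, id_vcomp]

theorem isCartesian_idCell (P : Pro a b) : IsCartesian (idCell P) :=
  isCartesian_of_isIso (𝟙 P)

theorem IsCartesian.pre_iso {P' : Pro a b} {φ : Cell f g P Q} (hφ : IsCartesian φ) (θ : P' ⟶ P)
    [IsIso θ] : IsCartesian (pre θ φ) :=
  IsCartesian.comp (isCartesian_of_isIso θ) hφ _ _

theorem iso_hom_cancel {P' : Pro a b} (e : P' ≅ P) {φ ψ : Cell f g P Q}
    (h : pre e.hom φ = pre e.hom ψ) : φ = ψ := by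
  have key : ∀ φ : Cell f g P Q, pre e.inv (pre e.hom φ) = φ := fun φ => by
    rw [pre, pre, vreassoc e.inv_hom_id]; exact id_vcomp φ
  rw [← key φ, h, key]

end Cartesian

/-! ## Companions and conjoints -/

section Companion

variable {c q : D} {i : c ⟶ q} {X : Pro c q} {J : Pro q c}

/-- The restriction `q(1, i)` is a companion of `i`. Lifting `unitCell i` through `α` gives the unit
and the first identity; the second is tested after composing with `α`. -/
theorem exists_companion_unit {α : Cell i (𝟙 q) X (U q)} (hα : IsCartesian α) :
    ∃ u : Cell (𝟙 c) i (U c) X, vcomp u α (Category.id_comp i) (Category.comp_id i) = unitCell i ∧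
      rc u α = lunitHom X := by
  obtain ⟨u, hu⟩ := hα.exists_lift (unitCell i) (Category.id_comp i) (Category.comp_id i)
  refine ⟨u, hu, hα.hom_ext (p := Category.id_comp i) (q := Category.comp_id _) ?_⟩
  rw [rc_post _ _ _ _ _ (Category.comp_id i), hu, vcomp_unitCell_id, ← lc_eq_rc, lc_unitCell]

theorem exists_conjoint_unit {β : Cell (𝟙 q) i J (U q)} (hβ : IsCartesian β) :
    ∃ u : Cell i (𝟙 c) (U c) J, vcomp u β (Category.comp_id i) (Category.id_comp i) = unitCell i ∧
      lc β u = runitHom J := by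
  obtain ⟨u, hu⟩ := hβ.exists_lift (unitCell i) (Category.comp_id i) (Category.id_comp i)
  refine ⟨u, hu, hβ.hom_ext (p := Category.comp_id _) (q := Category.id_comp i) ?_⟩
  rw [lc_post _ _ _ _ _ (Category.comp_id i), hu, vcomp_unitCell_id, lc_unitCell_right]

variable {x y : D}

/-- By the companion identity, `lunitHom X` followed by `θ` equals `rc` of `u` followed by `θ` with
`α` followed by `unitCell t`, so `θ` can be rebuilt from its restriction along `u`. -/
theorem companion_hom_ext {α : Cell i (𝟙 q) X (U q)} {u : Cell (𝟙 c) i (U c) X}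
    (hu : rc u α = lunitHom X) {s : c ⟶ x} {t : q ⟶ y} {R : Pro x y} {θ θ' : Cell s t X R}
    {k : c ⟶ y} {p : i ≫ t = k}
    (h : vcomp u θ (Category.id_comp s) p = vcomp u θ' (Category.id_comp s) p) : θ = θ' := by
  refine lunit_cancel ?_
  rw [← hu, rc_post _ _ _ _ _ p, h, ← rc_post]

theorem conjoint_hom_ext {β : Cell (𝟙 q) i J (U q)} {u : Cell i (𝟙 c) (U c) J}
    (hu : lc β u = runitHom J) {s : q ⟶ x} {t : c ⟶ y} {R : Pro x y} {θ θ' : Cell s t J R}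
    {k : c ⟶ x} {p : i ≫ s = k}
    (h : vcomp u θ p (Category.id_comp t) = vcomp u θ' p (Category.id_comp t)) : θ = θ' := by
  refine runit_cancel ?_
  rw [← hu, lc_post _ _ _ _ _ p, h, ← lc_post]

/-- A cell out of `A ⊙ X`, for a companion `X`, is determined by its restriction along the unit
of `X`. -/
theorem pcomp_companion_hom_ext {b : D} {A : Pro b c} {α : Cell i (𝟙 q) X (U q)}
    {u : Cell (𝟙 c) i (U c) X}
    (hu : rc u α = lunitHom X) {s : b ⟶ x} {t : q ⟶ y} {R : Pro x y} {θ θ' : Cell s t (pcomp A X) R}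
    {k : c ⟶ y} {p : i ≫ t = k} (h : vcomp (hcomp (idCell A) u) θ (Category.id_comp s) p =
      vcomp (hcomp (idCell A) u) θ' (Category.id_comp s) p) : θ = θ' := by
  -- The companion identity tensored with `A`; it rebuilds a cell out of `A ⊙ X` from its
  -- restriction along `A ⊙ u`.
  have e : vcomp (assocHom A (U c) X) (hcomp (idCell A) (lunitHom X)) (Category.comp_id _)
      (Category.comp_id _) = rc (hcomp (idCell A) u) α := by
    rw [← hu, rc, rc, post, post]
    nth_rewrite 1 [← vcomp_id (idCell A)]
    rw [interchange (q := Category.comp_id _),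
      vreassoc (assoc_natural (idCell A) u α).symm, vassoc' (Category.comp_id _)
      (Category.comp_id _), runit_pcomp]
  have e' : vcomp (hcomp (idCell A) (lunitInv X)) (hcomp (idCell A) (lunitHom X))
      (Category.comp_id _) (Category.comp_id _) = idCell _ := by
    rw [← interchange (q := Category.comp_id _), vcomp_id, lunit_inv_hom, hcomp_id]
  have key : vcomp (hcomp (idCell A) (lunitHom X)) θ (Category.id_comp s) (Category.id_comp t) =
      vcomp (hcomp (idCell A) (lunitHom X)) θ' (Category.id_comp s) (Category.id_comp t) := by
    refine assocInv_cancel ?_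
    rw [vreassoc e, vreassoc e, rc_post _ _ _ _ _ p, h, ← rc_post]
  rw [← id_vcomp θ, ← id_vcomp θ', ← e', vassoc' (Category.id_comp s) (Category.id_comp t), key,
    ← vassoc']

/-- Cells into a unit with right frame `i` are determined by their horizontal composite with the
companion of `i`. -/
theorem lc_companion_cancel {α : Cell i (𝟙 q) X (U q)} {u : Cell (𝟙 c) i (U c) X}
    (hu : vcomp u α (Category.id_comp i) (Category.comp_id i) = unitCell i)
    {s : x ⟶ q} {A : Pro x c} {φ ψ : Cell s i A (U q)} (h : lc φ α = lc ψ α) : φ = ψ := by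
  refine runit_cancel ?_
  have := congrArg (fun θ => vcomp (hcomp (idCell A) u) θ (Category.id_comp s)
    (Category.comp_id i)) h
  rwa [pre_lc _ _ _ _ _ _ (Category.id_comp i), pre_lc _ _ _ _ _ _ (Category.id_comp i), hu,
    id_vcomp, id_vcomp, lc_unitCell_right, lc_unitCell_right] at this

/-- The composite `q(1, i) ⊙ P` is the restriction `P(1, i)`: the lift of `χ` is `u ⊙ χ`, with `u`
the companion unit and the left unitor absorbed. This is the bridge between composing with a
universal module and restricting along `i`. -/
theorem isCartesian_lc_companion {α : Cell i (𝟙 q) X (U q)} (hα : IsCartesian α) {d : D}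
    (P : Pro q d) : IsCartesian (lc α (idCell P)) := by
  obtain ⟨u, hu, hu'⟩ := exists_companion_unit hα
  have key : hcomp u (lc α (idCell P)) = lunitHom (pcomp X P) := by
    refine assocInv_cancel (x := c) (c := c) ?_
    rw [lunit_pcomp, ← hu', lc, rc, post, post]
    nth_rewrite 1 [← vcomp_id u]
    rw [interchange (q := Category.comp_id _), vreassoc (assoc_natural u α (idCell P)).symm,
      vassoc' (Category.comp_id _) (Category.comp_id _), triangle,
      ← interchange (q := Category.comp_id _), vcomp_id]
  apply IsCartesian.of_existsUnique
  intro x y h k s t R χ p r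
  obtain rfl : k = t := (Category.comp_id k).symm.trans r
  refine ⟨vcomp (lunitInv R) (hcomp (vcomp (unitCell h) u (Category.comp_id h) p) χ)
    (Category.id_comp h) (Category.id_comp k), ?_, fun ψ e => ?_⟩
  · simp only
    rw [vassoc' p r, pre_lc _ _ _ _ _ _ (Category.comp_id s),
      vassoc' (Category.id_comp i) (Category.comp_id i), hu, unitCell_comp', vcomp_id, lc_unitCell,
      vreassoc (lunit_inv_hom R), id_vcomp]
  · refine lunit_cancel ?_
    rw [vreassoc (lunit_hom_inv R), id_vcomp, ← e, interchange (q := p), key]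
    exact (lunit_natural ψ).symm

theorem isCartesian_rc_conjoint {β : Cell (𝟙 q) i J (U q)} (hβ : IsCartesian β) {d : D}
    (P : Pro d q) : IsCartesian (rc (idCell P) β) := by
  obtain ⟨u, hu, hu'⟩ := exists_conjoint_unit hβ
  have key : hcomp (rc (idCell P) β) u = runitHom (pcomp P J) := by
    rw [← runit_pcomp, ← hu', lc, rc, post, post]
    nth_rewrite 1 [← vcomp_id u]
    nth_rewrite 2 [← vcomp_id (idCell P)]
    rw [interchange (q := Category.comp_id _), interchange (q := Category.comp_id _),
      vreassoc (assoc_natural (idCell P) β u).symm,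
      vassoc' (Category.comp_id _) (Category.comp_id _), triangle]
  apply IsCartesian.of_existsUnique
  intro x y h k s t R χ p r
  obtain rfl : h = s := (Category.comp_id h).symm.trans p
  refine ⟨vcomp (runitInv R) (hcomp χ (vcomp (unitCell k) u r (Category.comp_id k)))
    (Category.id_comp h) (Category.id_comp k), ?_, fun ψ e => ?_⟩
  · simp only
    rw [vassoc' p r, pre_rc _ _ _ _ _ _ (Category.comp_id t),
      vassoc' (Category.comp_id i) (Category.id_comp i), hu, unitCell_comp', vcomp_id, rc_unitCell,
      vreassoc (runit_inv_hom R), id_vcomp]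
  · refine runit_cancel ?_
    rw [vreassoc (runit_hom_inv R), id_vcomp, ← e, interchange (q := r), key]
    exact (runit_natural ψ).symm

end Companion

/-! ## Monoids and embeddings in terms of cells -/

section Monoids

/-- The unit of a monoid, as a cell. -/
def Mon.one {c : D} (M : Mon c) : Cell (𝟙 c) (𝟙 c) (U c) (Mon.pro M) := M.η

/-- The multiplication of a monoid, as a cell. -/
def Mon.mul {c : D} (M : Mon c) : Cell (𝟙 c) (𝟙 c) (pcomp (Mon.pro M) (Mon.pro M)) (Mon.pro M) :=
  M.μ

variable {c x y : D} {M : Mon c} {f : c ⟶ x}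

theorem Embedding.one_cell (F : Embedding M f) :
    vcomp (Mon.one M) F.cell (Category.id_comp f) (Category.id_comp f) = unitCell f := F.unit

theorem Embedding.mul_cell (F : Embedding M f) :
    vcomp (Mon.mul M) F.cell (Category.id_comp f) (Category.id_comp f) = lc F.cell F.cell := F.mul

/-- The composite of an embedding with a vertical arrow. -/
def Embedding.comp (F : Embedding M f) (h : x ⟶ y) {k : c ⟶ y} (e : f ≫ h = k) :
    Embedding M k where
  cell := vcomp F.cell (unitCell h) e e
  unit := by
    change vcomp (Mon.one M) _ _ _ = _
    rw [vreassoc F.one_cell, unitCell_comp']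
  mul := by
    change vcomp (Mon.mul M) _ _ _ = lc _ _
    rw [vreassoc F.mul_cell, lc_post _ _ _ _ _ e]

theorem Embedding.factors_comp (F : Embedding M f) (h : x ⟶ y) {k : c ⟶ y} (e : f ≫ h = k) :
    F.Factors (F.comp h e) h := ⟨e, rfl⟩

end Monoids

/-! ## Left modules and left embeddings -/

section Left

variable {c b x y q : D} {M : Mon c}

/-- `l` is a left action of the monoid `M` on the proarrow `X`. -/
structure LAct (M : Mon c) {b : D} (X : Pro c b)
    (l : Cell (𝟙 c) (𝟙 b) (pcomp (Mon.pro M) X) X) : Prop where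
  one : vcomp (hcomp (Mon.one M) (idCell X)) l (Category.comp_id _) (Category.comp_id _) =
    lunitHom X
  mul : vcomp (hcomp (Mon.mul M) (idCell X)) l (Category.comp_id _) (Category.comp_id _) =
    vcomp (assocHom _ _ _) (vcomp (hcomp (idCell _) l) l (Category.comp_id _) (Category.comp_id _))
      (Category.comp_id _) (Category.comp_id _)

/-- The module with a given action. -/
def LAct.toLMod {X : Pro c b} {l : Cell (𝟙 c) (𝟙 b) (pcomp (Mon.pro M) X) X} (h : LAct M X l) :
    Bicategory.LMod (B := Hor D) M ⟨b⟩ where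
  X := X
  act := l
  unit_act := h.one
  mul_act := h.mul

theorem LAct.of_LMod (X : Bicategory.LMod (B := Hor D) M ⟨b⟩) : LAct M (b := b) X.X X.act :=
  ⟨X.unit_act, X.mul_act⟩

/-- The action of `M` on `X ⊙ Y` induced by an action on `X`. -/
def extendAct {X : Pro c b} (l : Cell (𝟙 c) (𝟙 b) (pcomp (Mon.pro M) X) X) (Y : Pro b x) :
    Cell (𝟙 c) (𝟙 x) (pcomp (Mon.pro M) (pcomp X Y)) (pcomp X Y) :=
  vcomp (assocInv _ _ _) (hcomp l (idCell Y)) (Category.comp_id _) (Category.comp_id _)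

theorem LAct.extend {X : Pro c b} {l : Cell (𝟙 c) (𝟙 b) (pcomp (Mon.pro M) X) X} (h : LAct M X l)
    (Y : Pro b x) : LAct M (pcomp X Y) (extendAct l Y) :=
  LAct.of_LMod (b := x) ((h.toLMod.extend ⟨x⟩).obj Y)

/-- The cell `φ` carries the action `l` to the action of the unit on its target, along `F`. -/
def IsLEmb {f : c ⟶ x} {g : b ⟶ y} (F : Cell f f (Mon.pro M) (U x)) {X : Pro c b}
    (l : Cell (𝟙 c) (𝟙 b) (pcomp (Mon.pro M) X) X) {P : Pro x y} (φ : Cell f g X P) : Prop :=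
  vcomp l φ (Category.id_comp f) (Category.id_comp g) = lc F φ

variable {f : c ⟶ x} {g : b ⟶ y} {F : Cell f f (Mon.pro M) (U x)} {X : Pro c b}
  {l : Cell (𝟙 c) (𝟙 b) (pcomp (Mon.pro M) X) X} {P : Pro x y} {φ : Cell f g X P}

theorem IsLEmb.comp (hφ : IsLEmb F l φ) {x' y' : D} {h : x ⟶ x'} {k : y ⟶ y'} {Q : Pro x' y'}
    (χ : Cell h k P Q) {s : c ⟶ x'} {t : b ⟶ y'} (p : f ≫ h = s) (r : g ≫ k = t) :
    IsLEmb (vcomp F (unitCell h) p p) l (vcomp φ χ p r) := by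
  rw [IsLEmb, vreassoc hφ, lc_post _ _ _ _ _ p]

theorem IsLEmb.comp_id_frame (hφ : IsLEmb F l φ) {y' : D} {k : y ⟶ y'} {Q : Pro x y'}
    (χ : Cell (𝟙 x) k P Q) {t : b ⟶ y'} (r : g ≫ k = t) :
    IsLEmb F l (vcomp φ χ (Category.comp_id f) r) := by
  have := hφ.comp χ (Category.comp_id f) r
  rwa [vcomp_unitCell_id] at this

theorem IsLEmb.of_comp {x' y' : D} {h : x ⟶ x'} {k : y ⟶ y'} {Q : Pro x' y'}
    {χ : Cell h k P Q} (hχ : IsCartesian χ) {s : c ⟶ x'} {t : b ⟶ y'} {p : f ≫ h = s}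
    {r : g ≫ k = t} (hφ : IsLEmb (vcomp F (unitCell h) p p) l (vcomp φ χ p r)) :
    IsLEmb F l φ := by
  refine hχ.hom_ext (p := p) (q := r) ?_
  rw [vassoc' p r, hφ, lc_post _ _ _ _ _ p]

theorem IsLEmb.of_comp_id_frame {y' : D} {k : y ⟶ y'} {Q : Pro x y'}
    {χ : Cell (𝟙 x) k P Q} (hχ : IsCartesian χ) {t : b ⟶ y'}
    {r : g ≫ k = t} (hφ : IsLEmb F l (vcomp φ χ (Category.comp_id f) r)) :
    IsLEmb F l φ := by
  refine IsLEmb.of_comp hχ (p := Category.comp_id f) (r := r) ?_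
  rwa [vcomp_unitCell_id]

theorem IsLEmb.precomp {X' : Pro c b} {l' : Cell (𝟙 c) (𝟙 b) (pcomp (Mon.pro M) X') X'}
    (hφ : IsLEmb F l φ) (w : Cell (𝟙 c) (𝟙 b) X' X)
    (hw : vcomp l' w (Category.comp_id _) (Category.comp_id _) =
      vcomp (hcomp (idCell _) w) l (Category.comp_id _) (Category.comp_id _)) :
    IsLEmb F l' (vcomp w φ (Category.id_comp f) (Category.id_comp g)) := by
  rw [IsLEmb, vreassoc hw, vassoc' (Category.id_comp f) (Category.id_comp g), hφ,
    pre_lc _ _ _ _ _ _ (Category.id_comp f), id_vcomp]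

/-- Converse of `IsLEmb.precomp`: equivariance can be tested after a cartesian cell. Module maps
into a restriction are therefore the same as left embeddings into the restricted proarrow. -/
theorem IsLEmb.equivariant {X' : Pro c b} {l' : Cell (𝟙 c) (𝟙 b) (pcomp (Mon.pro M) X') X'}
    (hφ : IsLEmb F l φ) (hc : IsCartesian φ) {w : Cell (𝟙 c) (𝟙 b) X' X}
    (hw : IsLEmb F l' (vcomp w φ (Category.id_comp f) (Category.id_comp g))) :
    vcomp l' w (Category.comp_id _) (Category.comp_id _) =
      vcomp (hcomp (idCell _) w) l (Category.comp_id _) (Category.comp_id _) := by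
  refine hc.hom_ext (p := Category.id_comp f) (q := Category.id_comp g) ?_
  rw [vassoc' (Category.id_comp f) (Category.id_comp g), hw,
    vassoc' (Category.id_comp f) (Category.id_comp g), hφ,
    pre_lc _ _ _ _ _ _ (Category.id_comp f), id_vcomp]

theorem lc_hcomp {a a' d d' : D} {f : a ⟶ x} {g : b ⟶ x} {h : d ⟶ y} {k : d' ⟶ a'} {A : Pro a b}
    {B : Pro b d} {C : Pro d d'} {P : Pro x y} {Q : Pro y a'} (φ : Cell f g A (U x))
    (ψ : Cell g h B P) (χ : Cell h k C Q) :
    vcomp (assocHom A B C) (lc φ (hcomp ψ χ)) (Category.id_comp f) (Category.id_comp k) =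
      hcomp (lc φ ψ) χ := by
  rw [lc, lc, post, post]
  nth_rewrite 2 [← vcomp_id χ]
  rw [interchange (q := Category.comp_id _), vreassoc (assoc_natural φ ψ χ).symm,
    vassoc' (Category.comp_id _) (Category.comp_id _), lunit_pcomp]

theorem IsLEmb.hcomp_right (hφ : IsLEmb F l φ) {d d' : D} {k : d ⟶ d'} {Y : Pro b d} {Q : Pro y d'}
    (ψ : Cell g k Y Q) : IsLEmb F (extendAct l Y) (hcomp φ ψ) := by
  refine assocInv_cancel ?_
  rw [extendAct, lc_hcomp, vassoc' (Category.id_comp f) (Category.id_comp k),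
    vreassoc (assoc_hom_inv _ _ _), id_vcomp, ← interchange (q := Category.id_comp g), hφ, id_vcomp]

theorem IsLEmb.lc_right {f : c ⟶ x} {g : b ⟶ x} {F : Cell f f (Mon.pro M) (U x)} {φ : Cell f g X (U x)}
    (hφ : IsLEmb F l φ) {d d' : D} {k : d ⟶ d'} {Y : Pro b d} {Q : Pro x d'}
    (ψ : Cell g k Y Q) : IsLEmb F (extendAct l Y) (lc φ ψ) :=
  (hφ.hcomp_right ψ).comp_id_frame (lunitHom Q) (Category.comp_id k)

/-- An embedding of monoids and a cartesian cell induce an action. -/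
theorem Embedding.exists_lact (F : Embedding M f) {φ : Cell f g X P} (hφ : IsCartesian φ) :
    ∃ l, LAct M X l ∧ IsLEmb F.cell l φ := by
  obtain ⟨l, hl⟩ := hφ.exists_lift (lc F.cell φ) (Category.id_comp f) (Category.id_comp g)
  refine ⟨l, ⟨?_, ?_⟩, hl⟩
  · refine hφ.hom_ext (p := Category.id_comp f) (q := Category.id_comp g) ?_
    rw [vassoc' (Category.id_comp f) (Category.id_comp g), hl,
      pre_lc _ _ _ _ _ _ (Category.id_comp f), F.one_cell, id_vcomp, lc_unitCell]
  · refine hφ.hom_ext (p := Category.id_comp f) (q := Category.id_comp g) ?_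
    rw [vassoc' (Category.id_comp f) (Category.id_comp g), hl,
      pre_lc _ _ _ _ _ _ (Category.id_comp f), F.mul_cell, id_vcomp,
      vassoc' (Category.id_comp f) (Category.id_comp g),
      vassoc' (Category.id_comp f) (Category.id_comp g), hl,
      pre_lc _ _ _ _ _ _ (Category.id_comp f), hl, id_vcomp, lc_assoc]

/-- Cells out of `M` which are left embeddings are determined by their values on the unit. -/
theorem IsLEmb.hom_ext_one {g : c ⟶ y} {P : Pro x y} {φ ψ : Cell f g (Mon.pro M) P}
    (hφ : IsLEmb F (Mon.mul M) φ) (hψ : IsLEmb F (Mon.mul M) ψ)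
    (h : vcomp (Mon.one M) φ (Category.id_comp f) (Category.id_comp g) =
      vcomp (Mon.one M) ψ (Category.id_comp f) (Category.id_comp g)) : φ = ψ := by
  -- In elements, `φ(m) = φ(m · 1) = F(m) · φ(1)`, and likewise for `ψ`.
  have e : vcomp (hcomp (idCell (Mon.pro M)) (Mon.one M)) (Mon.mul M) (Category.comp_id _)
      (Category.comp_id _) = runitHom _ := M.μ_η
  refine runit_cancel ?_
  rw [← e, vassoc' (Category.id_comp f) (Category.id_comp g), hφ,
    vassoc' (Category.id_comp f) (Category.id_comp g), hψ,
    pre_lc _ _ _ _ _ _ (Category.id_comp f), h, ← pre_lc]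

theorem lact_mul (M : Mon c) : LAct M (Mon.pro M) (Mon.mul M) := ⟨M.η_μ, M.assoc⟩

end Left

/-! ## Universality for left modules -/

section LUniv

variable {c q : D} {M : Mon c} {i : c ⟶ q}

/-- Every left module is the restriction along `i` of a proarrow which is universal for left
embeddings. -/
structure LUniv (ι : Cell i i (Mon.pro M) (U q)) : Prop where
  exists_cartesian : ∀ {b : D} {X : Pro c b} {l : Cell (𝟙 c) (𝟙 b) (pcomp (Mon.pro M) X) X},
    LAct M X l → ∃ (Y : Pro q b) (φ : Cell i (𝟙 b) X Y), IsCartesian φ ∧ IsLEmb ι l φ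
  existsUnique : ∀ {b : D} {X : Pro c b} {l : Cell (𝟙 c) (𝟙 b) (pcomp (Mon.pro M) X) X},
    LAct M X l → ∀ {Y : Pro q b} {φ : Cell i (𝟙 b) X Y}, IsCartesian φ → IsLEmb ι l φ →
    ∀ {Z : Pro q b} (χ : Cell i (𝟙 b) X Z), IsLEmb ι l χ →
      ∃! ψ : Cell (𝟙 q) (𝟙 b) Y Z, vcomp φ ψ (Category.comp_id i) (Category.comp_id _) = χ

/-- Arbitrary frames `h`, `k` reduce to identities by lifting through the restriction `Z(k, h)`. -/
theorem LUniv.existsUnique_frames (hD : IsEquipment D) {ι : Cell i i (Mon.pro M) (U q)}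
    (H : LUniv ι) {b : D} {X : Pro c b} {l : Cell (𝟙 c) (𝟙 b) (pcomp (Mon.pro M) X) X}
    (hl : LAct M X l) {Y : Pro q b} {φ : Cell i (𝟙 b) X Y} (hφ : IsCartesian φ)
    (hφ' : IsLEmb ι l φ) {x y : D} {h : q ⟶ x} {k : b ⟶ y} {f : c ⟶ x} {Z : Pro x y} (p : i ≫ h = f)
    (χ : Cell f k X Z) (hχ : IsLEmb (vcomp ι (unitCell h) p p) l χ) :
    ∃! ψ : Cell h k Y Z, vcomp φ ψ p (Category.id_comp k) = χ := by
  obtain ⟨Z', ζ, hζ⟩ := hD h k Z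
  obtain ⟨χ', rfl⟩ := hζ.exists_lift χ p (Category.id_comp k)
  obtain ⟨ψ, hψ, hψ'⟩ := H.existsUnique hl hφ hφ' χ' (IsLEmb.of_comp hζ hχ)
  refine ⟨vcomp ψ ζ (Category.id_comp h) (Category.id_comp k), ?_, fun θ hθ => ?_⟩
  · simp only at hψ ⊢
    rw [vreassoc hψ]
  · obtain ⟨θ', rfl⟩ := hζ.exists_lift θ (Category.id_comp h) (Category.id_comp k)
    rw [hψ' θ' (hζ.hom_ext (p := p) (q := Category.id_comp k) ?_)]
    rw [← hθ, vassoc' (Category.id_comp h) (Category.id_comp k)]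

variable {L : Bicategory.LMod (B := Hor D) M ⟨q⟩} {α : Cell i (𝟙 q) L.X (U q)}
  {ι : Cell i i (Mon.pro M) (U q)}

/-- Naturality in `Y` of the canonical cell `q(1, i) ⊙ Y ⟶ Y`. -/
theorem lc_idCell_vcomp {X : Pro c q} (α : Cell i (𝟙 q) X (U q)) {b : D} {Y Z : Pro q b}
    (ψ : Cell (𝟙 q) (𝟙 b) Y Z) :
    vcomp (lc α (idCell Y)) ψ (Category.comp_id i) (Category.comp_id _) =
      vcomp (hcomp (idCell X) ψ) (lc α (idCell Z)) (Category.id_comp i) (Category.id_comp _) := by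
  rw [lc_post _ _ _ _ _ (Category.comp_id _), pre_lc _ _ _ _ _ _ (Category.comp_id _),
    vcomp_unitCell_id, id_vcomp, id_vcomp, vcomp_id]

/-- Essential surjectivity writes each module as some `q(1, i) ⊙ Y`, a restriction of `Y`. Full
faithfulness gives unique factorization, since left embeddings into `Z` are module maps into `q(1,
i) ⊙ Z`. -/
theorem LUniv.of_isUniversal (hα : IsCartesian α) (hL : IsLEmb (b := q) ι L.act α)
    (H : L.IsUniversal) : LUniv ι where
  exists_cartesian {b X l} hl := by
    have := (H ⟨b⟩).essSurj
    let e := (L.extend ⟨b⟩).objObjPreimageIso hl.toLMod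
    let Y : Pro q b := (L.extend ⟨b⟩).objPreimage hl.toLMod
    let w : X ⟶ pcomp (D := D) L.X Y := e.inv.hom
    have : IsIso w := ⟨e.hom.hom, congrArg Bicategory.LMod.Hom.hom e.inv_hom_id,
      congrArg Bicategory.LMod.Hom.hom e.hom_inv_id⟩
    exact ⟨Y, pre w (lc α (idCell Y)), IsCartesian.pre_iso (isCartesian_lc_companion hα Y) w,
      (hL.lc_right (idCell Y)).precomp w e.inv.comm⟩
  existsUnique {b X l} hl {Y φ} hφ hφ' {Z} χ hχ := by
    have := (H ⟨b⟩).full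
    have := (H ⟨b⟩).faithful
    have hY : IsCartesian (lc α (idCell Y)) := isCartesian_lc_companion hα Y
    have hZ : IsCartesian (lc α (idCell Z)) := isCartesian_lc_companion hα Z
    -- The given `X` and `q(1, i) ⊙ Y` are both restrictions of `Y` along `i`, hence isomorphic, and
    -- equivariantly so.
    obtain ⟨w, hw⟩ := hY.exists_iso hφ
    obtain ⟨χ', rfl⟩ := hZ.exists_lift χ (Category.id_comp i) (Category.id_comp _)
    let χ₁ : hl.toLMod ⟶ (L.extend ⟨b⟩).obj Z := ⟨χ', (hL.lc_right (idCell Z)).equivariant hZ hχ⟩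
    have hw' : IsLEmb ι (extendAct L.act Y) (pre w.hom φ) := by
      rw [hw]; exact hL.lc_right (idCell Y)
    let w₁ : (L.extend ⟨b⟩).obj Y ⟶ hl.toLMod :=
      ⟨w.hom, hφ'.equivariant hφ (w := w.hom) hw'⟩
    obtain ⟨ψ, hψ⟩ := (L.extend ⟨b⟩).map_surjective (w₁ ≫ χ₁)
    have hψ' : hcomp (D := D) (idCell L.X) ψ = vcomp w.hom χ' (Category.comp_id _)
      (Category.comp_id _) := congrArg Bicategory.LMod.Hom.hom hψ
    have key : ∀ θ : Cell (𝟙 q) (𝟙 b) Y Z,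
        vcomp w.hom (vcomp φ θ (Category.comp_id i) (Category.comp_id _)) (Category.id_comp _)
          (Category.id_comp _) = vcomp (hcomp (D := D) (idCell L.X) θ) (lc α (idCell Z))
            (Category.id_comp i) (Category.id_comp _) := fun θ => by
      rw [vreassoc hw, lc_idCell_vcomp]
    refine ⟨ψ, ?_, fun θ hθ => ?_⟩
    · refine iso_hom_cancel w ?_
      rw [pre, key, hψ', vassoc' (Category.id_comp _) (Category.id_comp _)]
    · refine (L.extend ⟨b⟩).map_injective (Bicategory.LMod.Hom.ext ?_)
      refine Eq.trans ?_ hψ'.symm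
      refine hZ.hom_ext (p := Category.id_comp i) (q := Category.id_comp _) ?_
      refine (key θ).symm.trans ?_
      rw [hθ]
      exact (vassoc' (Category.id_comp i) (Category.id_comp _) _ _ _ _ _ _ _).symm

/-- Unique factorization through the canonical cells `q(1, i) ⊙ Y ⟶ Y` gives full faithfulness.
Essential surjectivity holds because any restriction of `Y` along `i` is isomorphic to `q(1, i) ⊙
Y`. -/
theorem LUniv.isUniversal (hα : IsCartesian α) (hL : IsLEmb (b := q) ι L.act α) (H : LUniv ι) :
    L.IsUniversal := by
  rintro ⟨b⟩
  have hl (Y : Pro q b) : LAct M (pcomp (D := D) L.X Y) (extendAct L.act Y) :=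
    (LAct.of_LMod L).extend Y
  have hc (Y : Pro q b) : IsCartesian (lc α (idCell Y)) := isCartesian_lc_companion hα Y
  have he (Y : Pro q b) : IsLEmb ι (extendAct L.act Y) (lc α (idCell Y)) := hL.lc_right (idCell Y)
  refine ⟨⟨fun {Y Z} θ θ' h => ?_⟩, ⟨fun {Y Z} w => ?_⟩, ⟨fun X => ?_⟩⟩
  · have h' : hcomp (D := D) (idCell L.X) θ = hcomp (idCell L.X) θ' :=
      congrArg Bicategory.LMod.Hom.hom h
    refine (H.existsUnique (hl Y) (hc Y) (he Y) _
      ((he Y).comp_id_frame θ (Category.comp_id _))).unique rfl ?_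
    rw [lc_idCell_vcomp, lc_idCell_vcomp, h']
  · obtain ⟨ψ, hψ, -⟩ := H.existsUnique (hl Y) (hc Y) (he Y) _ ((he Z).precomp w.hom w.comm)
    refine ⟨ψ, Bicategory.LMod.Hom.ext ?_⟩
    refine IsCartesian.hom_ext (hc Z) (p := Category.id_comp i) (q := Category.id_comp _) ?_
    exact (lc_idCell_vcomp α ψ).symm.trans hψ
  · obtain ⟨Y, φ, hφ, hφ'⟩ := H.exists_cartesian (LAct.of_LMod (b := b) X)
    obtain ⟨w, hw⟩ := IsCartesian.exists_iso (hc Y) hφ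
    have hw' : pre w.inv (lc α (idCell Y)) = φ := by
      refine iso_hom_cancel w ?_
      rw [hw, pre, pre, vreassoc w.hom_inv_id]
      exact id_vcomp _
    have h₁ : IsLEmb ι (extendAct L.act Y) (pre w.hom φ) := by rw [hw]; exact he Y
    have h₂ : IsLEmb (b := b) ι X.act (pre w.inv (lc α (idCell Y))) := by rw [hw']; exact hφ'
    refine ⟨Y, ⟨⟨⟨w.hom, hφ'.equivariant hφ (w := w.hom) h₁⟩,
      ⟨w.inv, (he Y).equivariant (hc Y) (w := w.inv) h₂⟩,
      Bicategory.LMod.Hom.ext w.hom_inv_id, Bicategory.LMod.Hom.ext w.inv_hom_id⟩⟩⟩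

end LUniv

/-! ## Right modules and right embeddings -/

section Right

variable {c b x y q : D} {N : Mon c}

/-- `r` is a right action of the monoid `N` on the proarrow `X`. -/
structure RAct (N : Mon c) {b : D} (X : Pro b c)
    (r : Cell (𝟙 b) (𝟙 c) (pcomp X (Mon.pro N)) X) : Prop where
  one : vcomp (hcomp (idCell X) (Mon.one N)) r (Category.comp_id _) (Category.comp_id _) =
    runitHom X
  mul : vcomp (hcomp (idCell X) (Mon.mul N)) r (Category.comp_id _) (Category.comp_id _) =
    vcomp (assocInv _ _ _) (vcomp (hcomp r (idCell _)) r (Category.comp_id _) (Category.comp_id _))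
      (Category.comp_id _) (Category.comp_id _)

/-- The module with a given action. -/
def RAct.toRMod {X : Pro b c} {r : Cell (𝟙 b) (𝟙 c) (pcomp X (Mon.pro N)) X} (h : RAct N X r) :
    Bicategory.RMod (B := Hor D) N ⟨b⟩ where
  X := X
  act := r
  act_unit := h.one
  act_mul := h.mul

theorem RAct.of_RMod (X : Bicategory.RMod (B := Hor D) N ⟨b⟩) : RAct N (b := b) X.X X.act :=
  ⟨X.act_unit, X.act_mul⟩

/-- The action of `N` on `Y ⊙ X` induced by an action on `X`. -/
def rextendAct {X : Pro b c} (r : Cell (𝟙 b) (𝟙 c) (pcomp X (Mon.pro N)) X) (Y : Pro x b) :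
    Cell (𝟙 x) (𝟙 c) (pcomp (pcomp Y X) (Mon.pro N)) (pcomp Y X) :=
  vcomp (assocHom _ _ _) (hcomp (idCell Y) r) (Category.comp_id _) (Category.comp_id _)

theorem RAct.extend {X : Pro b c} {r : Cell (𝟙 b) (𝟙 c) (pcomp X (Mon.pro N)) X} (h : RAct N X r)
    (Y : Pro x b) : RAct N (pcomp Y X) (rextendAct r Y) :=
  RAct.of_RMod (b := x) ((h.toRMod.extend ⟨x⟩).obj Y)

/-- The cell `φ` carries the action `r` to the action of the unit on its target, along `G`. -/
def IsREmb {f : b ⟶ x} {g : c ⟶ y} (G : Cell g g (Mon.pro N) (U y)) {X : Pro b c}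
    (r : Cell (𝟙 b) (𝟙 c) (pcomp X (Mon.pro N)) X) {P : Pro x y} (φ : Cell f g X P) : Prop :=
  vcomp r φ (Category.id_comp f) (Category.id_comp g) = rc φ G

variable {f : b ⟶ x} {g : c ⟶ y} {G : Cell g g (Mon.pro N) (U y)} {X : Pro b c}
  {r : Cell (𝟙 b) (𝟙 c) (pcomp X (Mon.pro N)) X} {P : Pro x y} {φ : Cell f g X P}

theorem IsREmb.comp (hφ : IsREmb G r φ) {x' y' : D} {h : x ⟶ x'} {k : y ⟶ y'} {Q : Pro x' y'}
    (χ : Cell h k P Q) {s : b ⟶ x'} {t : c ⟶ y'} (p : f ≫ h = s) (e : g ≫ k = t) :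
    IsREmb (vcomp G (unitCell k) e e) r (vcomp φ χ p e) := by
  rw [IsREmb, vreassoc hφ, rc_post _ _ _ _ _ e]

theorem IsREmb.comp_id_frame (hφ : IsREmb G r φ) {x' : D} {h : x ⟶ x'} {Q : Pro x' y}
    (χ : Cell h (𝟙 y) P Q) {s : b ⟶ x'} (p : f ≫ h = s) :
    IsREmb G r (vcomp φ χ p (Category.comp_id g)) := by
  have := hφ.comp χ p (Category.comp_id g)
  rwa [vcomp_unitCell_id] at this

theorem IsREmb.of_comp {x' y' : D} {h : x ⟶ x'} {k : y ⟶ y'} {Q : Pro x' y'}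
    {χ : Cell h k P Q} (hχ : IsCartesian χ) {s : b ⟶ x'} {t : c ⟶ y'} {p : f ≫ h = s}
    {e : g ≫ k = t} (hφ : IsREmb (vcomp G (unitCell k) e e) r (vcomp φ χ p e)) :
    IsREmb G r φ := by
  refine hχ.hom_ext (p := p) (q := e) ?_
  rw [vassoc' p e, hφ, rc_post _ _ _ _ _ e]

theorem IsREmb.precomp {X' : Pro b c} {r' : Cell (𝟙 b) (𝟙 c) (pcomp X' (Mon.pro N)) X'}
    (hφ : IsREmb G r φ) (w : Cell (𝟙 b) (𝟙 c) X' X)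
    (hw : vcomp r' w (Category.comp_id _) (Category.comp_id _) =
      vcomp (hcomp w (idCell _)) r (Category.comp_id _) (Category.comp_id _)) :
    IsREmb G r' (vcomp w φ (Category.id_comp f) (Category.id_comp g)) := by
  rw [IsREmb, vreassoc hw, vassoc' (Category.id_comp f) (Category.id_comp g), hφ,
    pre_rc _ _ _ _ _ _ (Category.id_comp g), id_vcomp]

theorem IsREmb.equivariant {X' : Pro b c} {r' : Cell (𝟙 b) (𝟙 c) (pcomp X' (Mon.pro N)) X'}
    (hφ : IsREmb G r φ) (hc : IsCartesian φ) {w : Cell (𝟙 b) (𝟙 c) X' X}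
    (hw : IsREmb G r' (vcomp w φ (Category.id_comp f) (Category.id_comp g))) :
    vcomp r' w (Category.comp_id _) (Category.comp_id _) =
      vcomp (hcomp w (idCell _)) r (Category.comp_id _) (Category.comp_id _) := by
  refine hc.hom_ext (p := Category.id_comp f) (q := Category.id_comp g) ?_
  rw [vassoc' (Category.id_comp f) (Category.id_comp g), hw,
    vassoc' (Category.id_comp f) (Category.id_comp g), hφ,
    pre_rc _ _ _ _ _ _ (Category.id_comp g), id_vcomp]

theorem rc_hcomp {a a' d d' : D} {f : a ⟶ y} {g : b ⟶ y} {h : d ⟶ x} {k : d' ⟶ a'} {A : Pro a b}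
    {B : Pro d a} {C : Pro d' d} {P : Pro x y} {Q : Pro a' x} (χ : Cell k h C Q)
    (ψ : Cell h f B P) (φ : Cell f g A (U y)) :
    vcomp (assocHom C B A) (hcomp χ (rc ψ φ)) (Category.id_comp k) (Category.id_comp g) =
      rc (hcomp χ ψ) φ := by
  rw [rc, rc, post, post]
  nth_rewrite 1 [← vcomp_id χ]
  rw [interchange (q := Category.comp_id _), vreassoc (assoc_natural χ ψ φ).symm,
    vassoc' (Category.comp_id _) (Category.comp_id _), runit_pcomp]

theorem IsREmb.hcomp_left (hφ : IsREmb G r φ) {d d' : D} {k : d ⟶ d'} {Y : Pro d b} {Q : Pro d' x}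
    (ψ : Cell k f Y Q) : IsREmb G (rextendAct r Y) (hcomp ψ φ) := by
  rw [IsREmb, rextendAct, ← rc_hcomp, vassoc' (Category.id_comp k) (Category.id_comp g),
    ← interchange (q := Category.id_comp f), hφ, id_vcomp]

theorem IsREmb.rc_left {f : b ⟶ y} {g : c ⟶ y} {G : Cell g g (Mon.pro N) (U y)}
    {φ : Cell f g X (U y)} (hφ : IsREmb G r φ) {d d' : D} {k : d ⟶ d'} {Y : Pro d b} {Q : Pro d' y}
    (ψ : Cell k f Y Q) : IsREmb G (rextendAct r Y) (rc ψ φ) :=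
  (hφ.hcomp_left ψ).comp_id_frame (runitHom Q) (Category.comp_id k)

/-- An embedding of monoids and a cartesian cell induce an action. -/
theorem Embedding.exists_ract (G : Embedding N g) {φ : Cell f g X P} (hφ : IsCartesian φ) :
    ∃ r, RAct N X r ∧ IsREmb G.cell r φ := by
  obtain ⟨r, hr⟩ := hφ.exists_lift (rc φ G.cell) (Category.id_comp f) (Category.id_comp g)
  refine ⟨r, ⟨?_, ?_⟩, hr⟩
  · refine hφ.hom_ext (p := Category.id_comp f) (q := Category.id_comp g) ?_
    rw [vassoc' (Category.id_comp f) (Category.id_comp g), hr,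
      pre_rc _ _ _ _ _ _ (Category.id_comp g), G.one_cell, id_vcomp, rc_unitCell]
  · refine hφ.hom_ext (p := Category.id_comp f) (q := Category.id_comp g) ?_
    rw [vassoc' (Category.id_comp f) (Category.id_comp g), hr,
      pre_rc _ _ _ _ _ _ (Category.id_comp g), G.mul_cell, id_vcomp,
      vassoc' (Category.id_comp f) (Category.id_comp g),
      vassoc' (Category.id_comp f) (Category.id_comp g), hr,
      pre_rc _ _ _ _ _ _ (Category.id_comp g), hr, id_vcomp, ← rc_assoc,
      vreassoc (assoc_inv_hom _ _ _), id_vcomp]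

end Right

/-! ## Universality for right modules -/

section RUniv

variable {d q : D} {N : Mon d} {j : d ⟶ q}

/-- Every right module is the restriction along `j` of a proarrow which is universal for right
embeddings. -/
structure RUniv (ι : Cell j j (Mon.pro N) (U q)) : Prop where
  exists_cartesian : ∀ {b : D} {X : Pro b d} {r : Cell (𝟙 b) (𝟙 d) (pcomp X (Mon.pro N)) X},
    RAct N X r → ∃ (Y : Pro b q) (φ : Cell (𝟙 b) j X Y), IsCartesian φ ∧ IsREmb ι r φ
  existsUnique : ∀ {b : D} {X : Pro b d} {r : Cell (𝟙 b) (𝟙 d) (pcomp X (Mon.pro N)) X},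
    RAct N X r → ∀ {Y : Pro b q} {φ : Cell (𝟙 b) j X Y}, IsCartesian φ → IsREmb ι r φ →
    ∀ {Z : Pro b q} (χ : Cell (𝟙 b) j X Z), IsREmb ι r χ →
      ∃! ψ : Cell (𝟙 b) (𝟙 q) Y Z, vcomp φ ψ (Category.comp_id _) (Category.comp_id j) = χ

theorem RUniv.existsUnique_frames (hD : IsEquipment D) {ι : Cell j j (Mon.pro N) (U q)}
    (H : RUniv ι) {b : D} {X : Pro b d} {r : Cell (𝟙 b) (𝟙 d) (pcomp X (Mon.pro N)) X}
    (hr : RAct N X r) {Y : Pro b q} {φ : Cell (𝟙 b) j X Y} (hφ : IsCartesian φ)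
    (hφ' : IsREmb ι r φ) {x y : D} {h : b ⟶ x} {k : q ⟶ y} {g : d ⟶ y} {Z : Pro x y} (p : j ≫ k = g)
    (χ : Cell h g X Z) (hχ : IsREmb (vcomp ι (unitCell k) p p) r χ) :
    ∃! ψ : Cell h k Y Z, vcomp φ ψ (Category.id_comp h) p = χ := by
  obtain ⟨Z', ζ, hζ⟩ := hD h k Z
  obtain ⟨χ', rfl⟩ := hζ.exists_lift χ (Category.id_comp h) p
  obtain ⟨ψ, hψ, hψ'⟩ := H.existsUnique hr hφ hφ' χ' (IsREmb.of_comp hζ hχ)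
  refine ⟨vcomp ψ ζ (Category.id_comp h) (Category.id_comp k), ?_, fun θ hθ => ?_⟩
  · simp only at hψ ⊢
    rw [vreassoc hψ]
  · obtain ⟨θ', rfl⟩ := hζ.exists_lift θ (Category.id_comp h) (Category.id_comp k)
    rw [hψ' θ' (hζ.hom_ext (p := Category.id_comp h) (q := p) ?_)]
    rw [← hθ, vassoc' (Category.id_comp h) (Category.id_comp k)]

variable {R : Bicategory.RMod (B := Hor D) N ⟨q⟩} {β : Cell (𝟙 q) j R.X (U q)}
  {ι : Cell j j (Mon.pro N) (U q)}

theorem rc_idCell_vcomp {X : Pro q d} (β : Cell (𝟙 q) j X (U q)) {b : D} {Y Z : Pro b q}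
    (ψ : Cell (𝟙 b) (𝟙 q) Y Z) :
    vcomp (rc (idCell Y) β) ψ (Category.comp_id _) (Category.comp_id j) =
      vcomp (hcomp ψ (idCell X)) (rc (idCell Z) β) (Category.id_comp _) (Category.id_comp j) := by
  rw [rc_post _ _ _ _ _ (Category.comp_id _), pre_rc _ _ _ _ _ _ (Category.comp_id _),
    vcomp_unitCell_id, id_vcomp, id_vcomp, vcomp_id]

theorem RUniv.of_isUniversal (hβ : IsCartesian β) (hR : IsREmb (b := q) ι R.act β)
    (H : R.IsUniversal) : RUniv ι where
  exists_cartesian {b X r} hr := by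
    have := (H ⟨b⟩).essSurj
    let e := (R.extend ⟨b⟩).objObjPreimageIso hr.toRMod
    let Y : Pro b q := (R.extend ⟨b⟩).objPreimage hr.toRMod
    let w : X ⟶ pcomp (D := D) Y R.X := e.inv.hom
    have : IsIso w := ⟨e.hom.hom, congrArg Bicategory.RMod.Hom.hom e.inv_hom_id,
      congrArg Bicategory.RMod.Hom.hom e.hom_inv_id⟩
    exact ⟨Y, pre w (rc (idCell Y) β), IsCartesian.pre_iso (isCartesian_rc_conjoint hβ Y) w,
      (hR.rc_left (idCell Y)).precomp w e.inv.comm⟩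
  existsUnique {b X r} hr {Y φ} hφ hφ' {Z} χ hχ := by
    have := (H ⟨b⟩).full
    have := (H ⟨b⟩).faithful
    have hY : IsCartesian (rc (idCell Y) β) := isCartesian_rc_conjoint hβ Y
    have hZ : IsCartesian (rc (idCell Z) β) := isCartesian_rc_conjoint hβ Z
    obtain ⟨w, hw⟩ := hY.exists_iso hφ
    obtain ⟨χ', rfl⟩ := hZ.exists_lift χ (Category.id_comp _) (Category.id_comp j)
    let χ₁ : hr.toRMod ⟶ (R.extend ⟨b⟩).obj Z := ⟨χ', (hR.rc_left (idCell Z)).equivariant hZ hχ⟩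
    have hw' : IsREmb ι (rextendAct R.act Y) (pre w.hom φ) := by
      rw [hw]; exact hR.rc_left (idCell Y)
    let w₁ : (R.extend ⟨b⟩).obj Y ⟶ hr.toRMod :=
      ⟨w.hom, hφ'.equivariant hφ (w := w.hom) hw'⟩
    obtain ⟨ψ, hψ⟩ := (R.extend ⟨b⟩).map_surjective (w₁ ≫ χ₁)
    have hψ' : hcomp (D := D) ψ (idCell R.X) = vcomp w.hom χ' (Category.comp_id _)
      (Category.comp_id _) := congrArg Bicategory.RMod.Hom.hom hψ
    have key : ∀ θ : Cell (𝟙 b) (𝟙 q) Y Z,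
        vcomp w.hom (vcomp φ θ (Category.comp_id _) (Category.comp_id j)) (Category.id_comp _)
          (Category.id_comp _) = vcomp (hcomp (D := D) θ (idCell R.X)) (rc (idCell Z) β)
            (Category.id_comp _) (Category.id_comp j) := fun θ => by
      rw [vreassoc hw, rc_idCell_vcomp]
    refine ⟨ψ, ?_, fun θ hθ => ?_⟩
    · refine iso_hom_cancel w ?_
      rw [pre, key, hψ', vassoc' (Category.id_comp _) (Category.id_comp _)]
    · refine (R.extend ⟨b⟩).map_injective (Bicategory.RMod.Hom.ext ?_)
      refine Eq.trans ?_ hψ'.symm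
      refine hZ.hom_ext (p := Category.id_comp _) (q := Category.id_comp j) ?_
      refine (key θ).symm.trans ?_
      rw [hθ]
      exact (vassoc' (Category.id_comp _) (Category.id_comp j) _ _ _ _ _ _ _).symm

theorem RUniv.isUniversal (hβ : IsCartesian β) (hR : IsREmb (b := q) ι R.act β) (H : RUniv ι) :
    R.IsUniversal := by
  rintro ⟨b⟩
  have hr (Y : Pro b q) : RAct N (pcomp (D := D) Y R.X) (rextendAct R.act Y) :=
    (RAct.of_RMod R).extend Y
  have hc (Y : Pro b q) : IsCartesian (rc (idCell Y) β) := isCartesian_rc_conjoint hβ Y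
  have he (Y : Pro b q) : IsREmb ι (rextendAct R.act Y) (rc (idCell Y) β) :=
    hR.rc_left (idCell Y)
  refine ⟨⟨fun {Y Z} θ θ' h => ?_⟩, ⟨fun {Y Z} w => ?_⟩, ⟨fun X => ?_⟩⟩
  · have h' : hcomp (D := D) θ (idCell R.X) = hcomp θ' (idCell R.X) :=
      congrArg Bicategory.RMod.Hom.hom h
    refine (H.existsUnique (hr Y) (hc Y) (he Y) _
      ((he Y).comp_id_frame θ (Category.comp_id _))).unique rfl ?_
    rw [rc_idCell_vcomp, rc_idCell_vcomp, h']
  · obtain ⟨ψ, hψ, -⟩ := H.existsUnique (hr Y) (hc Y) (he Y) _ ((he Z).precomp w.hom w.comm)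
    refine ⟨ψ, Bicategory.RMod.Hom.ext ?_⟩
    refine IsCartesian.hom_ext (hc Z) (p := Category.id_comp _) (q := Category.id_comp j) ?_
    exact (rc_idCell_vcomp β ψ).symm.trans hψ
  · obtain ⟨Y, φ, hφ, hφ'⟩ := H.exists_cartesian (RAct.of_RMod (b := b) X)
    obtain ⟨w, hw⟩ := IsCartesian.exists_iso (hc Y) hφ
    have hw' : pre w.inv (rc (idCell Y) β) = φ := by
      refine iso_hom_cancel w ?_
      rw [hw, pre, pre, vreassoc w.hom_inv_id]
      exact id_vcomp _
    have h₁ : IsREmb ι (rextendAct R.act Y) (pre w.hom φ) := by rw [hw]; exact he Y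
    have h₂ : IsREmb (b := b) ι X.act (pre w.inv (rc (idCell Y) β)) := by rw [hw']; exact hφ'
    refine ⟨Y, ⟨⟨⟨w.hom, hφ'.equivariant hφ (w := w.hom) h₁⟩,
      ⟨w.inv, (he Y).equivariant (hc Y) (w := w.inv) h₂⟩,
      Bicategory.RMod.Hom.ext w.hom_inv_id, Bicategory.RMod.Hom.ext w.inv_hom_id⟩⟩⟩

end RUniv

end DoubleCategory

/-! ### Trivial monads; one-sided modules as bimodules -/

namespace CategoryTheory.Bicategory

variable {B : Type*} [Bicategory B]

/-- The trivial monad. -/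
def Mnd.triv (a : B) : Mnd a where
  t := 𝟙 a
  η := 𝟙 _
  μ := (λ_ (𝟙 a)).hom
  η_μ := by simp
  μ_η := by simp [unitors_equal]
  assoc := by simp [unitors_equal]

variable {a b : B} {M : Mnd a}

/-- A left module as a bimodule with trivial right action. -/
def LMod.toBimodule (X : LMod M b) : Bimodule M (Mnd.triv b) where
  X := X.X
  l := X.act
  r := (ρ_ X.X).hom
  unit_l := X.unit_act
  mul_l := X.mul_act
  r_unit := by simp [Mnd.triv]
  r_mul := by simp [Mnd.triv]
  l_r := by simp [Mnd.triv]

/-- A right module as a bimodule with trivial left action. -/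
def RMod.toBimodule (X : RMod M b) : Bimodule (Mnd.triv b) M where
  X := X.X
  l := (λ_ X.X).hom
  r := X.act
  unit_l := by simp [Mnd.triv]
  mul_l := by
    change (λ_ (𝟙 b)).hom ▷ X.X ≫ _ = (α_ (𝟙 b) (𝟙 b) X.X).hom ≫ 𝟙 b ◁ (λ_ X.X).hom ≫ _
    rw [unitors_equal, ← triangle_assoc]
  r_unit := X.act_unit
  r_mul := X.act_mul
  l_r := by simp [Mnd.triv]

end CategoryTheory.Bicategory

namespace DoubleCategory

variable {D : Type u} [DoubleCategory.{z, w, v} D]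

/-! ## Embeddings induced by actions on representable proarrows -/

section

variable {c d : D} {M : Mon c} {X : Pro c d} {g : c ⟶ d}
  {l : Cell (𝟙 c) (𝟙 d) (pcomp (Mon.pro M) X) X} {ξ : Cell g (𝟙 d) X (U d)}

/-- The action on `d(1, g)` determines the cell `M ⟶ U d`, because composing with a companion can be
cancelled. -/
theorem IsLEmb.cell_unique (hξ : IsCartesian ξ) {γ γ' : Cell g g (Mon.pro M) (U d)}
    (h : IsLEmb γ l ξ) (h' : IsLEmb γ' l ξ) : γ = γ' := by
  obtain ⟨u, hu, -⟩ := exists_companion_unit hξ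
  exact lc_companion_cancel hu (h.symm.trans h')

/-- The mate of the action: `γ` is `M ≅ M ⊙ U c ⟶ M ⊙ X ⟶ X ⟶ U d`, built from the companion unit,
`l` and `ξ`. -/
theorem LAct.exists_cell (hξ : IsCartesian ξ) : ∃ γ : Cell g g (Mon.pro M) (U d), IsLEmb γ l ξ := by
  obtain ⟨u, hu, hu'⟩ := exists_companion_unit hξ
  refine ⟨vcomp (runitInv _) (vcomp (hcomp (idCell _) u)
    (vcomp l ξ (Category.id_comp g) (Category.id_comp _)) (Category.id_comp g)
    (Category.comp_id g)) (Category.id_comp g) (Category.id_comp g), ?_⟩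
  refine pcomp_companion_hom_ext hu' (p := Category.comp_id g) ?_
  rw [pre_lc _ _ _ _ _ _ (Category.id_comp g), hu, id_vcomp, lc_unitCell_right,
    vreassoc (runit_hom_inv _), id_vcomp]

/-- An action of `M` on a proarrow represented by `g` is an embedding of `M` along `g`. -/
def LAct.embedding (h : LAct M X l) (hξ : IsCartesian ξ) {γ : Cell g g (Mon.pro M) (U d)}
    (hγ : IsLEmb γ l ξ) : Embedding M g where
  cell := γ
  unit := by
    obtain ⟨u, hu, -⟩ := exists_companion_unit hξ
    -- After composing with the companion `X`, the embedding laws become the module axioms followed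
    -- by `ξ`.
    refine lc_companion_cancel hu (φ := vcomp (Mon.one M) γ _ _) ?_
    rw [lc_unitCell, ← h.one, vassoc' (Category.id_comp g) (Category.id_comp _), hγ,
      pre_lc _ _ _ _ _ _ (Category.id_comp g), id_vcomp]
  mul := by
    obtain ⟨u, hu, -⟩ := exists_companion_unit hξ
    refine lc_companion_cancel hu (φ := vcomp (Mon.mul M) γ _ _) (ψ := lc γ γ) ?_
    have := congrArg (fun θ => vcomp θ ξ (Category.id_comp g) (Category.id_comp _)) h.mul
    rw [vassoc' (Category.id_comp g) (Category.id_comp _), hγ,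
      pre_lc _ _ _ _ _ _ (Category.id_comp g), id_vcomp,
      vassoc' (Category.id_comp g) (Category.id_comp _),
      vassoc' (Category.id_comp g) (Category.id_comp _), hγ,
      pre_lc _ _ _ _ _ _ (Category.id_comp g), id_vcomp, hγ, lc_assoc] at this
    exact this

end

/-! ## Trivial monoids -/

section Trivial

/-- The trivial monoid on an object. -/
abbrev Mon.triv (b : D) : Mon b := Bicategory.Mnd.triv (B := Hor D) ⟨b⟩

/-- The unit of a trivial monoid is an identity, so the unit law alone fixes the cell. -/
theorem Embedding.triv_cell {b x : D} {g : b ⟶ x} (G : Embedding (Mon.triv b) g) :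
    G.cell = unitCell g := by
  rw [← G.unit]
  exact (id_vcomp G.cell).symm

/-- The embedding of a trivial monoid along a vertical arrow. -/
def trivEmbedding {b x : D} (g : b ⟶ x) : Embedding (Mon.triv b) g where
  cell := unitCell g
  unit := id_vcomp _
  mul := (lc_unitCell (unitCell g)).symm

theorem Embedding.isBimodEmbedding_unit {c x : D} {M : Mon c} {f : c ⟶ x} (F : Embedding M f) :
    IsBimodEmbedding F F (Bicategory.Bimodule.unit M) F.cell :=
  ⟨F.mul, F.mul.trans (lc_eq_rc F.cell F.cell)⟩

theorem Embedding.factors_self {c x : D} {M : Mon c} {f : c ⟶ x} (F : Embedding M f) :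
    F.Factors F (𝟙 x) := ⟨Category.comp_id f, vcomp_unitCell_id _ _ _⟩

theorem trivEmbedding_isKernel (b : D) : (trivEmbedding (𝟙 b)).IsKernel := by
  rw [Embedding.IsKernel]
  change IsCartesian (unitCell (𝟙 b))
  rw [unitCell_id]
  exact isCartesian_idCell _

theorem trivEmbedding_isCollapse (b : D) : (trivEmbedding (𝟙 b)).IsCollapse := by
  intro x f F
  refine ⟨f, ⟨Category.id_comp f, ?_⟩, fun h hh => ?_⟩
  · rw [F.triv_cell]
    exact unitCell_comp' _ _ _ _
  · exact (Category.id_comp h).symm.trans hh.1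

/-- With an identity cover on one side, the second exactness axiom applies to one-sided modules. -/
theorem isRegularCover_id (b : D) : IsRegularCover (𝟙 b) := by
  refine ⟨Mon.triv b, trivEmbedding (𝟙 b), trivEmbedding_isKernel b, trivEmbedding_isCollapse b,
    trivEmbedding_isCollapse b, trivEmbedding_isCollapse b,
    Embedding.isBimodEmbedding_unit _, ?_⟩
  rintro x y f g F G Q χ - h k ⟨e₁, -⟩ ⟨e₂, -⟩
  obtain rfl : h = f := (Category.id_comp h).symm.trans e₁
  obtain rfl : k = g := (Category.id_comp k).symm.trans e₂
  have key : ∀ ψ : Cell h k (U b) Q, vcomp (trivEmbedding (𝟙 b)).cell ψ e₁ e₂ = ψ := fun ψ => by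
    change vcomp (unitCell (𝟙 b)) ψ _ _ = ψ
    rw [unitCell_id, id_vcomp]
  exact ⟨χ, key χ, fun ψ hψ => (key ψ).symm.trans hψ⟩

end Trivial

/-! ## Exact equipments satisfy Wood's axiom -/

section ExactWood

variable {c q : D} {M : Mon c} {i : c ⟶ q}

/-- This is effectiveness of `X` as a bimodule with trivial right action. The right frame `g` need
not be an identity. -/
theorem IsExact.exists_lemb (hE : IsExact D) {b : D} {X : Pro c b}
    {l : Cell (𝟙 c) (𝟙 b) (pcomp (Mon.pro M) X) X} (hl : LAct M X l) :
    ∃ (x y : D) (f : c ⟶ x) (g : b ⟶ y) (F : Embedding M f) (P : Pro x y) (φ : Cell f g X P),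
      F.IsKernel ∧ IsLEmb F.cell l φ ∧ IsCartesian φ := by
  obtain ⟨x, y, f, g, F, G, P, φ, hF, -, hφ, hφc⟩ := hE.bimodEffective hl.toLMod.toBimodule
  exact ⟨x, y, f, g, F, P, φ, hF, hφ.left, hφc⟩

theorem IsExact.exists_remb (hE : IsExact D) {b : D} {X : Pro b c}
    {r : Cell (𝟙 b) (𝟙 c) (pcomp X (Mon.pro M)) X} (hr : RAct M X r) :
    ∃ (x y : D) (f : b ⟶ x) (g : c ⟶ y) (G : Embedding M g) (P : Pro x y) (φ : Cell f g X P),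
      G.IsKernel ∧ IsREmb G.cell r φ ∧ IsCartesian φ := by
  obtain ⟨x, y, f, g, F, G, P, φ, -, hG, hφ, hφc⟩ := hE.bimodEffective hr.toRMod.toBimodule
  exact ⟨x, y, f, g, G, P, φ, hG, hφ.right, hφc⟩

theorem Embedding.IsNormalCollapse.existsUnique {I : Embedding M i} (hI : I.IsNormalCollapse)
    {x y : D} {f : c ⟶ x} {g : c ⟶ y} (F : Embedding M f) (G : Embedding M g) {Q : Pro x y}
    (χ : Cell f g (Mon.pro M) Q) (hl : IsLEmb F.cell (Mon.mul M) χ)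
    (hr : IsREmb G.cell (Mon.mul M) χ) {h : q ⟶ x} {k : q ⟶ y} (hF : I.Factors F h)
    (hG : I.Factors G k) : ∃! ψ : Cell h k (U q) Q, vcomp I.cell ψ hF.1 hG.1 = χ :=
  hI.2.universal F G χ ⟨hl, hr⟩ h k hF hG

/-- In an exact equipment, a normal collapse exhibits its monoid as a kernel. -/
theorem IsExact.isKernel (hD : IsEquipment D) (hE : IsExact D) {I : Embedding M i}
    (hI : I.IsNormalCollapse) : I.IsKernel := by
  obtain ⟨X, α, hα⟩ := hD i (𝟙 q) (U q)
  obtain ⟨u, hu, hu'⟩ := exists_companion_unit hα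
  obtain ⟨l, hl, hlα⟩ := I.exists_lact hα
  -- Effectiveness is applied to the module `q(1, i)`, not to `M`. Its kernel `F` factors as `I`
  -- followed by `unitCell h`, so it remains to see that `unitCell h` can be cancelled after cells
  -- into `U q` with frames through `i`.
  obtain ⟨x, y, f, g, F, P, φ, hF, hφl, hφc⟩ := hE.exists_lemb hl
  obtain ⟨h, ⟨rfl, hhF⟩, -⟩ := hI.1 F
  obtain ⟨a, ha⟩ := hα.exists_lift I.cell (Category.id_comp i) (Category.comp_id i)
  have haα : vcomp (Mon.one M) a (Category.comp_id _) (Category.id_comp i) = u := by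
    refine hα.hom_ext (p := Category.id_comp i) (q := Category.comp_id i) ?_
    rw [vassoc' (Category.id_comp i) (Category.comp_id i), ha, hu, I.one_cell]
  have hal : vcomp (Mon.mul M) a (Category.comp_id _) (Category.id_comp i) =
      vcomp (hcomp (idCell _) a) l (Category.comp_id _) (Category.comp_id i) := by
    refine hα.hom_ext (p := Category.id_comp i) (q := Category.comp_id i) ?_
    rw [vassoc' (Category.id_comp i) (Category.comp_id i), ha, I.mul_cell,
      vassoc' (Category.id_comp i) (Category.comp_id _), hlα,
      pre_lc _ _ _ _ _ _ (Category.id_comp i), ha, id_vcomp]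
  have har : vcomp (Mon.mul M) a (Category.comp_id _) (Category.id_comp i) = rc a I.cell := by
    refine hα.hom_ext (p := Category.id_comp i) (q := Category.comp_id i) ?_
    rw [vassoc' (Category.id_comp i) (Category.comp_id i), ha, I.mul_cell,
      rc_post _ _ _ _ _ (Category.comp_id i), ha, vcomp_unitCell_id, lc_eq_rc]
  have haφl : IsLEmb F.cell (Mon.mul M) (vcomp a φ (Category.id_comp _) rfl) := by
    rw [IsLEmb, vreassoc hal, vassoc' (Category.id_comp _) (Category.id_comp _), hφl,
      pre_lc _ _ _ _ _ _ (Category.id_comp _), id_vcomp]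
  have haφr : IsREmb (I.comp g rfl).cell (Mon.mul M) (vcomp a φ (Category.id_comp _) rfl) := by
    rw [IsREmb, vreassoc har, rc_post _ _ _ _ _ rfl]
    rfl
  -- Normality is used here: `a` followed by `φ` embeds the unit bimodule, so it extends along `I`
  -- to a cell `ζ` out of `U q`.
  obtain ⟨ζ, hζ, -⟩ := hI.existsUnique F (I.comp g rfl) _ haφl haφr (h := h) (k := g) ⟨rfl, hhF⟩
    (I.factors_comp g rfl)
  -- Cells out of the companion are tested on `u`, which is the unit of `M` followed by `a`.
  have hαζ : vcomp α ζ rfl (Category.id_comp g) = φ := by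
    refine companion_hom_ext hu' (p := rfl) ?_
    rw [vreassoc hu, ← haα, vassoc' (Category.id_comp _) rfl]
    rw [← hζ, vreassoc I.one_cell]
  -- By naturality of unitors, `χ` followed by `ζ` depends only on `χ` followed by `unitCell h`.
  -- Since `χ` factors through `α`, and `α` followed by `ζ` is the cartesian cell `φ`, this recovers
  -- `χ`.
  have key : ∀ {x' y' : D} {s : x' ⟶ c} {t : y' ⟶ c} {R : Pro x' y'}
      (χ χ' : Cell (s ≫ i) (t ≫ i) R (U q)),
      vcomp χ (unitCell h) rfl rfl = vcomp χ' (unitCell h) rfl rfl → χ = χ' := by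
    intro x' y' s t R χ χ' e
    have e' : vcomp χ ζ rfl rfl = vcomp χ' ζ rfl rfl := by
      refine runit_cancel ?_
      rw [vreassoc (lc_unitCell_right χ).symm, vreassoc (lc_unitCell_right χ').symm,
        lc_post _ _ _ _ _ rfl, e, ← lc_post]
    obtain ⟨θ, rfl⟩ := hα.exists_lift (h := s) (k := t ≫ i) χ rfl (Category.comp_id _)
    obtain ⟨θ', rfl⟩ := hα.exists_lift (h := s) (k := t ≫ i) χ' rfl (Category.comp_id _)
    rw [vassoc' rfl (Category.id_comp g), hαζ, vassoc' rfl (Category.id_comp g), hαζ] at e'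
    rw [hφc.hom_ext e']
  intro x' y' s t R χ
  obtain ⟨ψ, hψ⟩ := hF.exists_lift (h := s) (k := t) (vcomp χ (unitCell h) rfl rfl)
    (Category.assoc ..).symm (Category.assoc ..).symm
  rw [← hhF, vreassoc (p := rfl) (q := rfl) rfl] at hψ
  refine ⟨ψ, key _ _ hψ, fun ψ' e => ?_⟩
  refine IsCartesian.hom_ext hF (p := (Category.assoc ..).symm) (q := (Category.assoc ..).symm) ?_
  rw [← hhF, vreassoc (p := rfl) (q := rfl) e, vreassoc (p := rfl) (q := rfl) (key _ _ hψ)]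

theorem IsExact.isRegularCover (hD : IsEquipment D) (hE : IsExact D) {I : Embedding M i}
    (hI : I.IsNormalCollapse) : IsRegularCover i :=
  ⟨M, I, hE.isKernel hD hI, hI⟩

/-- A module embeds cartesianly into some `P` along a vertical arrow factoring as `i ≫ h`;
restricting `P` along `h` moves the embedding over `i`. Its universality is the second exactness
axiom for the covers `i` and `𝟙 b`. -/
theorem IsExact.lUniv (hD : IsEquipment D) (hE : IsExact D) {I : Embedding M i}
    (hI : I.IsNormalCollapse) : LUniv I.cell where
  exists_cartesian {b X l} hl := by
    obtain ⟨x, y, f, g, F, P, φ, -, hφl, hφc⟩ := hE.exists_lemb hl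
    obtain ⟨h, ⟨rfl, hhF⟩, -⟩ := hI.1 F
    obtain ⟨Y, π, hπ⟩ := hD h g P
    obtain ⟨φ', rfl⟩ := hπ.exists_lift φ rfl (Category.id_comp g)
    rw [← hhF] at hφl
    exact ⟨Y, φ', IsCartesian.of_comp hπ hφc, IsLEmb.of_comp hπ hφl⟩
  existsUnique {b X l} hl {Y φ} hφ hφ' {Z} χ hχ := by
    have h₁ : IsBimodEmbedding I (trivEmbedding (𝟙 b)) hl.toLMod.toBimodule φ :=
      ⟨hφ', (rc_unitCell φ).symm⟩
    have h₂ : IsBimodEmbedding I (trivEmbedding (𝟙 b)) hl.toLMod.toBimodule χ :=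
      ⟨hχ, (rc_unitCell χ).symm⟩
    exact (hE.regular.bimodCollapse i (𝟙 b) (hE.isRegularCover hD hI) (isRegularCover_id b) Y I
      (trivEmbedding (𝟙 b)) (hE.isKernel hD hI) (trivEmbedding_isKernel b) hl.toLMod.toBimodule φ h₁ hφ).universal
      I (trivEmbedding (𝟙 b)) χ h₂ (𝟙 q) (𝟙 b) I.factors_self (Embedding.factors_self _)

theorem IsExact.rUniv (hD : IsEquipment D) (hE : IsExact D) {I : Embedding M i}
    (hI : I.IsNormalCollapse) : RUniv I.cell where
  exists_cartesian {b X r} hr := by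
    obtain ⟨x, y, f, g, G, P, φ, -, hφr, hφc⟩ := hE.exists_remb hr
    obtain ⟨h, ⟨rfl, hhG⟩, -⟩ := hI.1 G
    obtain ⟨Y, π, hπ⟩ := hD f h P
    obtain ⟨φ', rfl⟩ := hπ.exists_lift φ (Category.id_comp f) rfl
    rw [← hhG] at hφr
    exact ⟨Y, φ', IsCartesian.of_comp hπ hφc, IsREmb.of_comp hπ hφr⟩
  existsUnique {b X r} hr {Y φ} hφ hφ' {Z} χ hχ := by
    have h₁ : IsBimodEmbedding (trivEmbedding (𝟙 b)) I hr.toRMod.toBimodule φ :=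
      ⟨(lc_unitCell φ).symm, hφ'⟩
    have h₂ : IsBimodEmbedding (trivEmbedding (𝟙 b)) I hr.toRMod.toBimodule χ :=
      ⟨(lc_unitCell χ).symm, hχ⟩
    exact (hE.regular.bimodCollapse (𝟙 b) i (isRegularCover_id b) (hE.isRegularCover hD hI) Y
      (trivEmbedding (𝟙 b)) I (trivEmbedding_isKernel b) (hE.isKernel hD hI) hr.toRMod.toBimodule φ h₁ hφ).universal
      (trivEmbedding (𝟙 b)) I χ h₂ (𝟙 b) (𝟙 q) (Embedding.factors_self _) I.factors_self

/-- Both `φ` and its composite with `w` are cartesian left embeddings of the same module, hence both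
universal. So restriction along `i` reflects isomorphisms. -/
theorem LUniv.isIso {ι : Cell i i (Mon.pro M) (U q)} (H : LUniv ι) {b : D} {X : Pro c b}
    {l : Cell (𝟙 c) (𝟙 b) (pcomp (Mon.pro M) X) X} (hl : LAct M X l) {Y Z : Pro q b}
    {φ : Cell i (𝟙 b) X Y} (hφ : IsCartesian φ) (hφ' : IsLEmb ι l φ) (w : Y ⟶ Z)
    (hw : IsCartesian (post φ w)) : IsIso w := by
  have hw' : IsLEmb ι l (post φ w) := hφ'.comp_id_frame w (Category.comp_id _)
  obtain ⟨t, ht, -⟩ := H.existsUnique hl hw hw' φ hφ'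
  refine ⟨t, (H.existsUnique hl hφ hφ' φ hφ').unique ?_ (vcomp_id φ),
    (H.existsUnique hl hw hw' _ hw').unique ?_ (vcomp_id _)⟩
  · change vcomp φ (vcomp w t _ _) _ _ = φ
    rw [vreassoc (p := Category.comp_id i) (q := Category.comp_id _) rfl]
    exact ht
  · change vcomp _ (vcomp t w _ _) _ _ = _
    rw [vreassoc ht]

/-- Restriction along `i` reflects cartesian cells: the comparison `w` from `P` to the actual
restriction of `Q` becomes cartesian after restricting along `i`, so `LUniv.isIso` makes it
invertible. -/
theorem LUniv.isCartesian_of_restrict (hD : IsEquipment D) {ι : Cell i i (Mon.pro M) (U q)}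
    (H : LUniv ι) {X : Pro c q} {α : Cell i (𝟙 q) X (U q)}
    (hα : IsCartesian α) {l : Cell (𝟙 c) (𝟙 q) (pcomp (Mon.pro M) X) X} (hl : LAct M X l)
    (hlα : IsLEmb ι l α) {d x y : D} {P : Pro q d} {f : q ⟶ x} {k : d ⟶ y} {Q : Pro x y}
    {ψ : Cell f k P Q} {g : c ⟶ x} {e : i ≫ f = g}
    (hξ : IsCartesian (vcomp (lc α (idCell P)) ψ e (Category.id_comp k))) : IsCartesian ψ := by
  have hc : ∀ Y : Pro q d, IsCartesian (lc α (idCell Y)) := fun Y => isCartesian_lc_companion hα Y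
  obtain ⟨P', ψ', hψ'⟩ := hD f k Q
  obtain ⟨w, rfl⟩ := hψ'.exists_lift ψ (Category.id_comp f) (Category.id_comp k)
  rw [vreassoc (lc_idCell_vcomp α w), vassoc' e (Category.id_comp k)] at hξ
  have h₁ : IsCartesian (vcomp (lc α (idCell P')) ψ' e (Category.id_comp k)) :=
    IsCartesian.comp (hc P') hψ' _ _
  have h₂ : IsCartesian (post (lc α (idCell P)) w) := by
    rw [post, lc_idCell_vcomp]
    exact IsCartesian.comp (IsCartesian.of_comp h₁ hξ) (hc P') _ _
  have : IsIso (X := P) (Y := P') w :=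
    H.isIso (hl.extend P) (hc P) (hlα.lc_right (idCell P)) w h₂
  have h₃ : IsCartesian (pre w ψ') := IsCartesian.pre_iso (P' := P) (P := P') hψ' w
  exact @h₃

/-- The representability condition of Wood's axiom, for a collapse which is universal for left
modules. -/
theorem LUniv.existsUnique_represents (hD : IsEquipment D) {I : Embedding M i}
    (hI : I.IsCollapse) (H : LUniv I.cell) {X : Pro c q} {α : Cell i (𝟙 q) X (U q)}
    (hα : IsCartesian α) {l : Cell (𝟙 c) (𝟙 q) (pcomp (Mon.pro M) X) X} (hl : LAct M X l)
    (hlα : IsLEmb I.cell l α) {d : D} (P : Pro q d) (g : c ⟶ d)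
    (ξ : Cell g (𝟙 d) (pcomp X P) (U d)) (hξ : Represents ξ) :
    ∃! f : q ⟶ d, ∃ (e : i ≫ f = g) (ψ : Cell f (𝟙 d) P (U d)),
      Represents ψ ∧ vcomp (restrictCell α P) ψ e (Category.comp_id (𝟙 d)) = ξ := by
  have hc : ∀ Y : Pro q d, IsCartesian (lc α (idCell Y)) := fun Y => isCartesian_lc_companion hα Y
  have he : ∀ Y : Pro q d, IsLEmb I.cell (extendAct l Y) (lc α (idCell Y)) :=
    fun Y => hlα.lc_right (idCell Y)
  -- The action of `M` on `X ⊙ P`, represented by `g`, is an embedding of `M` along `g`; the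
  -- collapse factors it through `f`.
  obtain ⟨γ, hγ⟩ := LAct.exists_cell (l := extendAct l P) hξ
  obtain ⟨f, ⟨e, hf⟩, hfu⟩ := hI ((hl.extend P).embedding hξ hγ)
  replace hf : vcomp I.cell (unitCell f) e e = γ := hf
  refine ⟨f, ⟨e, ?_⟩, ?_⟩
  · obtain ⟨ψ, hψ, -⟩ := H.existsUnique_frames hD (hl.extend P) (hc P) (he P) e ξ (hf ▸ hγ)
    refine ⟨ψ, ?_, hψ⟩
    rw [Represents] at hξ ⊢
    refine H.isCartesian_of_restrict hD hα hl hlα (e := e) ?_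
    rwa [hψ]
  -- A compatible `ψ'` makes `ξ` a left embedding along `I` followed by `unitCell f'`. The cell of
  -- an action on a representable is unique, so `f'` factors the same embedding.
  · rintro f' ⟨e', ψ', -, hψ'⟩
    refine hfu f' ⟨e', IsLEmb.cell_unique hξ ?_ hγ⟩
    have := (he P).comp ψ' e' (Category.comp_id _)
    rwa [← hψ']

theorem IsExact.woodAxiom5 (hD : IsEquipment D) (hE : IsExact D) : WoodAxiom5 D := by
  intro c M
  obtain ⟨q, i, I, hI⟩ := hE.regular.collapse M (hE.monEffective M)
  obtain ⟨X, α, hα⟩ := hD i (𝟙 q) (U q)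
  obtain ⟨Y, β, hβ⟩ := hD (𝟙 q) i (U q)
  obtain ⟨l, hl, hlα⟩ := I.exists_lact hα
  obtain ⟨r, hr, hrβ⟩ := I.exists_ract hβ
  have H := hE.lUniv hD hI
  have key := fun {d : D} => H.existsUnique_represents (d := d) hD hI.1 hα hl hlα
  refine ⟨q, i, I.cell, hl.toLMod, α, hr.toRMod, β, hα, hβ, hlα,
    hrβ.trans (lc_eq_rc β I.cell).symm, H.isUniversal (L := hl.toLMod) hα hlα,
    (hE.rUniv hD hI).isUniversal (R := hr.toRMod) hβ hrβ, ?_, key⟩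
  intro d P
  constructor
  · rintro ⟨f, ψ, hψ⟩
    exact ⟨i ≫ f, vcomp (restrictCell α P) ψ rfl (Category.comp_id _),
      IsCartesian.comp (isCartesian_lc_companion hα P) hψ _ _⟩
  · rintro ⟨g, ξ, hξ⟩
    obtain ⟨f, ⟨-, ψ, hψ, -⟩, -⟩ := key P g ξ hξ
    exact ⟨f, ψ, hψ⟩

end ExactWood

/-! ## Universal modules and collapses -/

section Collapse

variable {c q : D} {M : Mon c} {i : c ⟶ q}

/-- An embedding universal for left modules and satisfying the representability condition of
Wood's axiom is a collapse. -/
theorem LUniv.isCollapse (hD : IsEquipment D) {I : Embedding M i} (H : LUniv I.cell)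
    {X : Pro c q} {α : Cell i (𝟙 q) X (U q)} (hα : IsCartesian α)
    {l : Cell (𝟙 c) (𝟙 q) (pcomp (Mon.pro M) X) X} (hl : LAct M X l) (hlα : IsLEmb I.cell l α)
    (key : ∀ {d : D} (P : Pro q d) (g : c ⟶ d) (ξ : Cell g (𝟙 d) (pcomp X P) (U d)),
      Represents ξ → ∃! f : q ⟶ d, ∃ (e : i ≫ f = g) (ψ : Cell f (𝟙 d) P (U d)),
        Represents ψ ∧ vcomp (restrictCell α P) ψ e (Category.comp_id (𝟙 d)) = ξ) :
    I.IsCollapse := by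
  intro x f F
  -- The embedding `F` is encoded as an action on `x(1, f)`. This module descends to some `P` with
  -- `q(1, i) ⊙ P` represented by `f`, and the factorization `h` is the arrow representing `P`.
  obtain ⟨T, τ, hτ⟩ := hD f (𝟙 x) (U x)
  obtain ⟨l', hl', hτ'⟩ := F.exists_lact hτ
  obtain ⟨P, φ, hφ, hφ'⟩ := H.exists_cartesian hl'
  have hc : IsCartesian (lc α (idCell P)) := isCartesian_lc_companion hα P
  have he : IsLEmb I.cell (extendAct l P) (lc α (idCell P)) := hlα.lc_right (idCell P)
  obtain ⟨w, hw⟩ := hc.exists_iso hφ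
  have hw' : IsLEmb I.cell (extendAct l P) (pre w.hom φ) := by rw [hw]; exact he
  have hξ : IsCartesian (pre w.hom τ) := IsCartesian.pre_iso hτ w.hom
  have hξ' : IsLEmb F.cell (extendAct l P) (pre w.hom τ) :=
    hτ'.precomp w.hom (hφ'.equivariant hφ hw')
  obtain ⟨h, ⟨e, ψ, -, hψ⟩, hu⟩ := key P f _ hξ
  refine ⟨h, ⟨e, IsLEmb.cell_unique hξ ?_ hξ'⟩, ?_⟩
  · rw [← hψ]
    exact he.comp ψ e _
  -- Any factorization `h'` yields a cell `ψ'` by universality, cartesian because its restriction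
  -- along `i` is; uniqueness in `key` then applies.
  · rintro h' ⟨e', hh'⟩
    obtain ⟨ψ', hψ', -⟩ := H.existsUnique_frames hD (hl.extend P) hc he e' (pre w.hom τ)
      (by rw [hh']; exact hξ')
    refine hu h' ⟨e', ψ', ?_, hψ'⟩
    rw [Represents]
    refine H.isCartesian_of_restrict hD hα hl hlα (e := e') ?_
    rwa [hψ']

/-- The extension is `J ≅ J ⊙ U c ⟶ U q ⊙ P ≅ P`, induced by `β ⊙ θ`. Together with
`conjoint_hom_ext` it makes `u` universal among such cells out of `U c`. -/
theorem exists_conjoint_desc {J : Pro q c} {β : Cell (𝟙 q) i J (U q)} {u : Cell i (𝟙 c) (U c) J}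
    (hu : vcomp u β (Category.comp_id i) (Category.id_comp i) = unitCell i)
    {P : Pro q c} (θ : Cell i (𝟙 c) (U c) P) :
    ∃ t : J ⟶ P, vcomp u t (Category.comp_id i) (Category.comp_id _) = θ := by
  refine ⟨vcomp (runitInv J) (lc β θ) (Category.comp_id _) (Category.comp_id _),
    runit_cancel ?_⟩
  rw [vreassoc (p := Category.id_comp i) (q := Category.id_comp _) (rc_unitCell u).symm, rc, post,
    vassoc' (Category.comp_id _) (Category.comp_id _), vreassoc (runit_hom_inv J), id_vcomp,
    pre_lc _ _ _ _ _ _ (Category.id_comp i), hu, unitCell_id, id_vcomp, lc_unitCell, lunit_U]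

/-- An embedding which is universal for left modules exhibits its monoid as a kernel. -/
theorem LUniv.isKernel (hD : IsEquipment D) {I : Embedding M i} (H : LUniv I.cell) :
    I.IsKernel := by
  -- `M`, as a left module over itself, is a restriction of some `P`; the aim is `P ≅ q(i, 1)`, for
  -- then `M` is `U q` restricted along `i` on both sides.
  obtain ⟨P, φ, hφ, hφ'⟩ := H.exists_cartesian (lact_mul M)
  obtain ⟨J, β, hβ⟩ := hD (𝟙 q) i (U q)
  obtain ⟨u, hu, hu'⟩ := exists_conjoint_unit hβ
  obtain ⟨κ, hκ⟩ := hβ.exists_lift I.cell (Category.comp_id i) (Category.id_comp i)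
  have hκ' : IsLEmb I.cell (Mon.mul M) κ := by
    refine IsLEmb.of_comp_id_frame hβ (r := Category.id_comp i) ?_
    rw [hκ]
    exact I.mul_cell
  have hκu : vcomp (Mon.one M) κ (Category.id_comp i) (Category.id_comp _) = u := by
    refine hβ.hom_ext (p := Category.comp_id i) (q := Category.id_comp i) ?_
    rw [vassoc' (Category.comp_id i) (Category.id_comp i), hκ, hu, I.one_cell]
  obtain ⟨s, hs, -⟩ := H.existsUnique (lact_mul M) hφ hφ' κ hκ'
  obtain ⟨t, ht⟩ := exists_conjoint_desc hu
    (vcomp (Mon.one M) φ (Category.id_comp i) (Category.id_comp _))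
  have hs : vcomp φ s (Category.comp_id i) (Category.comp_id _) = κ := hs
  -- One composite is tested on `M`, where left embeddings are determined at the unit; the other on
  -- the conjoint unit `u`.
  have : IsIso (X := P) (Y := J) s := by
    refine ⟨t, (H.existsUnique (lact_mul M) hφ hφ' φ hφ').unique ?_ (vcomp_id φ), ?_⟩
    · change vcomp φ (vcomp s t _ _) _ _ = φ
      rw [vreassoc hs]
      refine IsLEmb.hom_ext_one (hκ'.comp_id_frame t (Category.comp_id _)) hφ' ?_
      rw [vreassoc hκu, ht]
    · refine conjoint_hom_ext hu' (p := Category.comp_id i) ?_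
      change vcomp u (vcomp t s _ _) _ _ = vcomp u (idCell J) _ _
      rw [vreassoc ht, vassoc' (Category.comp_id i) (Category.comp_id _), hs, hκu]
      exact (vcomp_id u).symm
  rw [Embedding.IsKernel, ← hκ, ← hs]
  exact IsCartesian.comp (IsCartesian.comp hφ (isCartesian_of_isIso (P := P) (P' := J) s) _ _) hβ
    _ _

end Collapse

/-! ## Bimodules -/

section Bimodules

variable {c d q r : D} {M : Mon c} {N : Mon d} {i : c ⟶ q} {j : d ⟶ r}

/-- Up to isomorphism `φ` is the canonical cell `i`-companion `⊙ Y ⟶ Y`. Tensoring this with `A`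
gives, up to the associator, the canonical cell for `Y ⊙ A`. -/
theorem isCartesian_hcomp_idCell (hD : IsEquipment D) {b e : D} {X : Pro c b} {Y : Pro q b}
    {φ : Cell i (𝟙 b) X Y} (hφ : IsCartesian φ) (A : Pro b e) :
    IsCartesian (hcomp φ (idCell A)) := by
  obtain ⟨Z, α, hα⟩ := hD i (𝟙 q) (U q)
  obtain ⟨w, hw⟩ := hφ.exists_iso (isCartesian_lc_companion hα Y)
  have h₁ : IsIso (hmap w.hom (𝟙 A)) := ⟨hmap w.inv (𝟙 A), by
    rw [← hmap_comp, w.hom_inv_id, Category.comp_id, hmap_id], by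
    rw [← hmap_comp, w.inv_hom_id, Category.comp_id, hmap_id]⟩
  have h₂ : IsCartesian (hcomp (lc α (idCell Y)) (idCell A)) := by
    rw [← lc_hcomp, hcomp_id]
    exact IsCartesian.pre_iso (isCartesian_lc_companion hα _) (assocIso Z Y A).hom
  have h₃ : hcomp φ (idCell A) = pre (hmap w.hom (𝟙 A)) (hcomp (lc α (idCell Y)) (idCell A)) := by
    rw [← hw]
    nth_rewrite 1 [← id_vcomp (idCell A)]
    exact interchange _ _ _ _ _ _ _
  rw [h₃]
  have h₄ := @IsCartesian.pre_iso _ _ _ _ _ _ _ _ _ _ _ _ @h₂ (hmap w.hom (𝟙 A)) h₁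
  exact @h₄

/-- The cell `φ ⊙ A` is again a universal left embedding, now of `X ⊙ A`. This allows identities
about right actions on `Y` to be checked on `X`. -/
theorem LUniv.hcomp_hom_ext (hD : IsEquipment D) {ι : Cell i i (Mon.pro M) (U q)} (H : LUniv ι)
    {b e : D} {X : Pro c b} {l : Cell (𝟙 c) (𝟙 b) (pcomp (Mon.pro M) X) X} (hl : LAct M X l)
    {Y : Pro q b} {φ : Cell i (𝟙 b) X Y} (hφ : IsCartesian φ) (hφ' : IsLEmb ι l φ) {A : Pro b e}
    {x y : D} {h : q ⟶ x} {k : e ⟶ y} {Z : Pro x y} {θ θ' : Cell h k (pcomp Y A) Z}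
    {s : c ⟶ x} {p : i ≫ h = s}
    (hθ : vcomp (hcomp φ (idCell A)) θ p (Category.id_comp k) =
      vcomp (hcomp φ (idCell A)) θ' p (Category.id_comp k)) : θ = θ' :=
  (H.existsUnique_frames hD (hl.extend A) (isCartesian_hcomp_idCell hD hφ A)
    (hφ'.hcomp_right (idCell A)) p _
    ((hφ'.hcomp_right (idCell A)).comp θ p (Category.id_comp k))).unique rfl hθ.symm

/-- The left module `X` descends to `Y`; the right action, being a map of left modules, descends
with it; then the right module `Y` descends to `P`. -/
theorem exists_bimod_cartesian (hD : IsEquipment D) {ι : Cell i i (Mon.pro M) (U q)}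
    {κ : Cell j j (Mon.pro N) (U r)} (H : LUniv ι) (K : RUniv κ) {X : Pro c d}
    {l : Cell (𝟙 c) (𝟙 d) (pcomp (Mon.pro M) X) X} {m : Cell (𝟙 c) (𝟙 d) (pcomp X (Mon.pro N)) X}
    (hl : LAct M X l) (hm : RAct N X m)
    (hlm : vcomp (hcomp l (idCell (Mon.pro N))) m (Category.comp_id _) (Category.comp_id _) =
      vcomp (assocHom _ _ _) (vcomp (hcomp (idCell _) m) l (Category.comp_id _)
        (Category.comp_id _)) (Category.comp_id _) (Category.comp_id _)) :
    ∃ (P : Pro q r) (φ : Cell i j X P), IsLEmb ι l φ ∧ IsREmb κ m φ ∧ IsCartesian φ := by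
  obtain ⟨Y, φ, hφ, hφ'⟩ := H.exists_cartesian hl
  -- Compatibility of the two actions says exactly that `m : X ⊙ N ⟶ X` is a map of left modules.
  have hm' : vcomp (extendAct l (Mon.pro N)) m (Category.comp_id _) (Category.comp_id _) =
      vcomp (hcomp (idCell _) m) l (Category.comp_id _) (Category.comp_id _) := by
    refine assocInv_cancel ?_
    rw [← hlm, extendAct, vassoc' (Category.comp_id _) (Category.comp_id _),
      vreassoc (assoc_hom_inv _ _ _), id_vcomp]
  obtain ⟨m', hm'', -⟩ := H.existsUnique (hl.extend (Mon.pro N))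
    (isCartesian_hcomp_idCell hD hφ (Mon.pro N)) (hφ'.hcomp_right (idCell _)) _
    (hφ'.precomp m hm')
  have hmφ : vcomp (hcomp φ (idCell (Mon.pro N))) m' (Category.comp_id i) (Category.comp_id _) =
    vcomp m φ (Category.id_comp i) (Category.id_comp _) := hm''
  have hY : RAct N Y m' := by
    constructor
    · refine H.hcomp_hom_ext hD hl hφ hφ' (p := Category.comp_id i) ?_
      have e : vcomp (hcomp φ (idCell (U d))) (hcomp (idCell Y) (Mon.one N)) (Category.comp_id i)
          (Category.comp_id _) = vcomp (hcomp (idCell X) (Mon.one N)) (hcomp φ (idCell _))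
          (Category.id_comp i) (Category.comp_id _) := by
        rw [← interchange (q := Category.comp_id _), ← interchange (q := Category.comp_id _)]
        rw [vcomp_id, id_vcomp, id_vcomp, vcomp_id]
      rw [vreassoc e, vassoc' (Category.comp_id i) (Category.comp_id _), hmφ, vreassoc hm.one,
        ← rc_unitCell, rc, unitCell_id]
    · refine H.hcomp_hom_ext hD hl hφ hφ' (p := Category.comp_id i) ?_
      have e : vcomp (hcomp φ (idCell _)) (hcomp (idCell Y) (Mon.mul N)) (Category.comp_id i)
          (Category.comp_id _) = vcomp (hcomp (idCell X) (Mon.mul N)) (hcomp φ (idCell _))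
          (Category.id_comp i) (Category.comp_id _) := by
        rw [← interchange (q := Category.comp_id _), ← interchange (q := Category.comp_id _)]
        rw [vcomp_id, id_vcomp, id_vcomp, vcomp_id]
      have e₂ : vcomp (hcomp φ (idCell (pcomp (Mon.pro N) (Mon.pro N)))) (assocInv _ _ _)
          (Category.comp_id i) (Category.comp_id _) = vcomp (assocInv _ _ _)
            (hcomp (hcomp φ (idCell (Mon.pro N))) (idCell (Mon.pro N))) (Category.id_comp i)
            (Category.id_comp _) := by
        refine assocInv_cancel ?_
        rw [vreassoc (assoc_hom_inv _ _ _), id_vcomp, ← hcomp_id,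
          vreassoc (assoc_natural φ (idCell (Mon.pro N)) (idCell (Mon.pro N))).symm,
          vassoc' (Category.comp_id _) (Category.comp_id _), assoc_hom_inv, vcomp_id]
      have e₃ : vcomp (hcomp (hcomp φ (idCell (Mon.pro N))) (idCell (Mon.pro N)))
          (hcomp m' (idCell _)) (Category.comp_id i) (Category.comp_id _) =
          vcomp (hcomp m (idCell _)) (hcomp φ (idCell _)) (Category.id_comp i)
            (Category.comp_id _) := by
        rw [← interchange (q := Category.comp_id _), ← interchange (q := Category.comp_id _), hmφ]
      rw [vreassoc e, vassoc' (Category.comp_id i) (Category.comp_id _), hmφ, vreassoc hm.mul,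
        vreassoc e₂, vassoc' (Category.comp_id i) (Category.comp_id _), vreassoc e₃,
        vassoc' (Category.comp_id i) (Category.comp_id _), hmφ,
        vassoc' (Category.id_comp i) (Category.id_comp _),
        vassoc' (Category.id_comp i) (Category.id_comp _)]
  obtain ⟨P, π, hπ, hπ'⟩ := K.exists_cartesian hY
  refine ⟨P, vcomp φ π (Category.comp_id i) (Category.id_comp j),
    hφ'.comp_id_frame π (Category.id_comp j), ?_, IsCartesian.comp hφ hπ _ _⟩
  rw [IsREmb, vreassoc hmφ.symm, vassoc' (Category.comp_id (𝟙 q)) (Category.id_comp j), hπ',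
    pre_rc _ _ _ _ _ _ (Category.id_comp j), id_vcomp]

/-- Through the one-sided restriction `Y` of `P` along `j`, the cell `φ` becomes a left-universal
cell followed by a right-universal one. So `χ` is extended first along the left factor and then
along the right. -/
theorem bimod_existsUnique (hD : IsEquipment D) {I : Embedding M i} {J : Embedding N j}
    (H : LUniv I.cell) (K : RUniv J.cell) {X : Pro c d}
    {l : Cell (𝟙 c) (𝟙 d) (pcomp (Mon.pro M) X) X} {m : Cell (𝟙 c) (𝟙 d) (pcomp X (Mon.pro N)) X}
    (hl : LAct M X l) {P : Pro q r} {φ : Cell i j X P} (hφ : IsCartesian φ)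
    (hφl : IsLEmb I.cell l φ) (hφm : IsREmb J.cell m φ) {x y : D} {f : c ⟶ x} {g : d ⟶ y}
    {F : Embedding M f} {G : Embedding N g} {Q : Pro x y} (χ : Cell f g X Q)
    (hχl : IsLEmb F.cell l χ) (hχm : IsREmb G.cell m χ) {h : q ⟶ x} {k : r ⟶ y}
    (hF : I.Factors F h) (hG : J.Factors G k) :
    ∃! ψ : Cell h k P Q, vcomp φ ψ hF.1 hG.1 = χ := by
  obtain ⟨p, hF⟩ := hF
  obtain ⟨p', hG⟩ := hG
  obtain ⟨Y, π, hπ⟩ := hD (𝟙 q) j P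
  obtain ⟨m', hY, hπm⟩ := J.exists_ract hπ
  obtain ⟨φ, rfl⟩ := hπ.exists_lift φ (Category.comp_id i) (Category.id_comp j)
  have hφc : IsCartesian φ := IsCartesian.of_comp hπ hφ
  have hφl' : IsLEmb I.cell l φ := IsLEmb.of_comp_id_frame hπ hφl
  have hmφ : vcomp (hcomp φ (idCell (Mon.pro N))) m' (Category.comp_id i) (Category.comp_id _) =
      vcomp m φ (Category.id_comp i) (Category.id_comp _) := by
    refine hπ.hom_ext (p := Category.comp_id i) (q := Category.id_comp j) ?_
    rw [vassoc' (Category.comp_id (𝟙 q)) (Category.id_comp j), hπm,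
      vassoc' (Category.comp_id i) (Category.id_comp j), hφm,
      pre_rc _ _ _ _ _ _ (Category.id_comp j), id_vcomp]
  rw [← hF] at hχl
  obtain ⟨χ', hχ', hu⟩ := H.existsUnique_frames hD hl hφc hφl' p χ hχl
  have hχ' : vcomp φ χ' p (Category.id_comp g) = χ := hχ'
  -- The intermediate extension respects the right action because this can be tested on `X ⊙ N`,
  -- where it is the hypothesis on `χ`.
  have hχm' : IsREmb (vcomp J.cell (unitCell k) p' p') m' χ' := by
    refine H.hcomp_hom_ext hD hl hφc hφl' (p := p) ?_
    rw [hG, vreassoc hmφ, vassoc' p (Category.id_comp g), hχ', hχm,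
      pre_rc _ _ _ _ _ _ (Category.id_comp g), hχ', id_vcomp]
  obtain ⟨ψ, hψ, hu'⟩ := K.existsUnique_frames hD hY hπ hπm p' χ' hχm'
  have hψ : vcomp π ψ (Category.id_comp h) p' = χ' := hψ
  refine ⟨ψ, ?_, fun θ hθ => hu' θ (hu _ ?_)⟩
  · change vcomp (vcomp φ π _ _) ψ _ _ = χ
    rw [vassoc' (Category.id_comp h) p', hψ, hχ']
  · change vcomp φ _ _ _ = χ
    rw [← hθ, vassoc' (Category.id_comp h) p']

end Bimodules

/-! ## Wood's axiom implies exactness -/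

section WoodExact

variable {c d : D}

/-- The restriction of an embedding along a morphism of monoids. -/
def Embedding.precomp {x : D} {K K' : Mon c} {e : c ⟶ x} (E : Embedding K e)
    (t : Cell (𝟙 c) (𝟙 c) (Mon.pro K') (Mon.pro K))
    (hone : vcomp (Mon.one K') t (Category.comp_id _) (Category.comp_id _) = Mon.one K)
    (hmul : vcomp (Mon.mul K') t (Category.comp_id _) (Category.comp_id _) =
      vcomp (hcomp t t) (Mon.mul K) (Category.comp_id _) (Category.comp_id _)) :
    Embedding K' e where
  cell := vcomp t E.cell (Category.id_comp e) (Category.id_comp e)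
  unit := by
    change vcomp (Mon.one K') _ _ _ = _
    rw [vreassoc hone, E.one_cell]
  mul := by
    change vcomp (Mon.mul K') _ _ _ = lc _ _
    rw [vreassoc hmul, vassoc' (Category.id_comp e) (Category.id_comp e), E.mul_cell,
      pre_lc _ _ _ _ _ _ (Category.id_comp e)]

/-- Two kernels of `f` are isomorphic as monoids, since units and multiplications are determined
after the cartesian cells. A regular cover supplies only one kernel, while the second exactness
axiom concerns all of them. -/
theorem Embedding.IsKernel.isCollapse {K K' : Mon c} {f : c ⟶ d} {F : Embedding K f}
    {F' : Embedding K' f} (hF : F.IsKernel) (hF' : F'.IsKernel) (h : F'.IsCollapse) :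
    F.IsCollapse := by
  intro x e E
  rw [Embedding.IsKernel] at hF hF'
  obtain ⟨θ, hθ⟩ := IsCartesian.exists_iso hF hF'
  obtain ⟨s, t, hst, hts⟩ := θ
  have hs : vcomp s F'.cell (Category.id_comp f) (Category.id_comp f) = F.cell := hθ
  have hst : vcomp s t (Category.comp_id _) (Category.comp_id _) = idCell (Mon.pro K) := hst
  have hts : vcomp t s (Category.comp_id _) (Category.comp_id _) = idCell (Mon.pro K') := hts
  have ht : vcomp t F.cell (Category.id_comp f) (Category.id_comp f) = F'.cell := by
    rw [← hs, vreassoc hts, id_vcomp]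
  have h₁ : vcomp (Mon.one K') t (Category.comp_id _) (Category.comp_id _) = Mon.one K := by
    refine hF.hom_ext (p := Category.id_comp f) (q := Category.id_comp f) ?_
    rw [vassoc' (Category.id_comp f) (Category.id_comp f), ht, F'.one_cell, F.one_cell]
  have h₂ : vcomp (Mon.mul K') t (Category.comp_id _) (Category.comp_id _) =
      vcomp (hcomp t t) (Mon.mul K) (Category.comp_id _) (Category.comp_id _) := by
    refine hF.hom_ext (p := Category.id_comp f) (q := Category.id_comp f) ?_
    rw [vassoc' (Category.id_comp f) (Category.id_comp f), ht, F'.mul_cell,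
      vassoc' (Category.id_comp f) (Category.id_comp f), F.mul_cell,
      pre_lc _ _ _ _ _ _ (Category.id_comp f), ht]
  have key (k : d ⟶ x) : F'.Factors (E.precomp t h₁ h₂) k ↔ F.Factors E k := by
    constructor
    · rintro ⟨p, hk⟩
      have hk : vcomp F'.cell (unitCell k) p p =
        vcomp t E.cell (Category.id_comp e) (Category.id_comp e) := hk
      refine ⟨p, ?_⟩
      rw [← hs, vassoc' p p, hk, vreassoc hst, id_vcomp]
    · rintro ⟨p, hk⟩
      refine ⟨p, ?_⟩
      change _ = vcomp t E.cell _ _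
      rw [← hk, ← ht, vassoc' p p]
  simp only [← key]
  exact h _

variable {q : D} {M : Mon c} {i : c ⟶ q}

theorem Embedding.Factors.trans {x y : D} {f : c ⟶ x} {g : c ⟶ y} {I : Embedding M i}
    {F : Embedding M f} {G : Embedding M g} {h : q ⟶ x} {k : x ⟶ y} (hF : I.Factors F h)
    (hG : F.Factors G k) : I.Factors G (h ≫ k) := by
  obtain ⟨p, hF⟩ := hF
  obtain ⟨r, hG⟩ := hG
  refine ⟨by rw [← Category.assoc, p, r], ?_⟩
  rw [← hG, ← hF, unitCell_comp, vassoc' rfl rfl]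

theorem Embedding.IsCollapse.exists_inverse {x : D} {f : c ⟶ x} {I : Embedding M i}
    {F : Embedding M f} (hI : I.IsCollapse) (hF : F.IsCollapse) :
    ∃ (h : q ⟶ x) (h' : x ⟶ q), I.Factors F h ∧ h ≫ h' = 𝟙 q ∧ h' ≫ h = 𝟙 x := by
  obtain ⟨h, hh, -⟩ := hI F
  obtain ⟨h', hh', -⟩ := hF I
  exact ⟨h, h', hh, (hI I).unique (hh.trans hh') I.factors_self,
    (hF F).unique (hh'.trans hh) F.factors_self⟩

/-- In Wood's axiom `ι` is only a cell; it is an embedding because it is the cell corresponding to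
the action on `q(1, i)`. -/
theorem WoodAxiom5.exists_universal (hD : IsEquipment D) (hW : WoodAxiom5 D) (M : Mon c) :
    ∃ (q : D) (i : c ⟶ q) (I : Embedding M i),
      I.IsCollapse ∧ I.IsKernel ∧ LUniv I.cell ∧ RUniv I.cell := by
  obtain ⟨q, i, ι, L, α, R, β, hα, hβ, hlα, hrβ, hL, hR, -, key⟩ := hW M
  have hlα : IsLEmb (b := q) ι L.act α := hlα
  have hrβ : IsREmb (b := q) ι R.act β := hrβ.trans (lc_eq_rc β ι)
  have H : LUniv ι := LUniv.of_isUniversal hα hlα hL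
  have K : RUniv ι := RUniv.of_isUniversal hβ hrβ hR
  let I : Embedding M i := (LAct.of_LMod L).embedding hα hlα
  exact ⟨q, i, I, LUniv.isCollapse hD (I := I) H hα (LAct.of_LMod L) hlα key,
    LUniv.isKernel hD (I := I) H, H, K⟩

/-- Only the collapse property of `F` and `G` matters: they agree with Wood's collapses up to the
vertical isomorphisms `h` and `k`. Restricting `B` along these gives an invertible cell `π`, along
which the universal property from `bimod_existsUnique` is transported. -/
theorem WoodAxiom5.isBimodCollapse (hD : IsEquipment D) (hW : WoodAxiom5 D) {c' d' : D}
    {K : Mon c} {L : Mon c'} {f : c ⟶ d} {g : c' ⟶ d'} {F : Embedding K f} {G : Embedding L g}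
    (hF : F.IsCollapse) (hG : G.IsCollapse) {B : Pro d d'} {R : Bimod K L}
    {φ : Cell f g (Bimod.pro R) B} (hφ : IsBimodEmbedding F G R φ) (hφc : IsCartesian φ) :
    IsBimodCollapse F G R φ := by
  refine ⟨hF, hG, hφ, fun {x y f₁ g₁} F₁ G₁ {Q} χ hχ a b hFa hGb => ?_⟩
  obtain ⟨q, i, I, hI, -, H, -⟩ := hW.exists_universal hD K
  obtain ⟨r, j, J, hJ, -, -, H'⟩ := hW.exists_universal hD L
  obtain ⟨h, h', hh, hh₁, hh₂⟩ := hI.exists_inverse hF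
  obtain ⟨k, k', hk, hk₁, hk₂⟩ := hJ.exists_inverse hG
  obtain ⟨B', π, hπ⟩ := hD h k B
  obtain ⟨π', hπ'⟩ := hπ.exists_lift (idCell B) hh₂ hk₂
  have hππ' : vcomp π π' hh₁ hk₁ = idCell B' := by
    refine hπ.hom_ext (p := Category.id_comp h) (q := Category.id_comp k) ?_
    rw [vassoc' hh₂ hk₂, hπ', vcomp_id, id_vcomp]
  obtain ⟨φ', hφ'⟩ := hπ.exists_lift φ hh.1 hk.1
  have hl : IsLEmb I.cell (b := c') R.l φ' := by
    refine IsLEmb.of_comp hπ (p := hh.1) (r := hk.1) ?_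
    rw [hφ', hh.2]
    exact hφ.left
  have hr : IsREmb J.cell (b := c) R.r φ' := by
    refine IsREmb.of_comp hπ (p := hh.1) (e := hk.1) ?_
    rw [hφ', hk.2]
    exact hφ.right
  have hc : IsCartesian φ' := by
    rw [← hφ'] at hφc
    exact IsCartesian.of_comp hπ hφc
  obtain ⟨ψ, hψ, hu⟩ := bimod_existsUnique hD H H' (X := Bimod.pro R) ⟨R.unit_l, R.mul_l⟩ hc hl hr χ
    hχ.left hχ.right (hh.trans hFa) (hk.trans hGb)
  have e₁ : h' ≫ h ≫ a = a := by rw [← Category.assoc, hh₂, Category.id_comp]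
  have e₂ : k' ≫ k ≫ b = b := by rw [← Category.assoc, hk₂, Category.id_comp]
  refine ⟨vcomp π' ψ e₁ e₂, ?_, fun θ hθ => ?_⟩
  · simp only at hψ ⊢
    rw [← hφ', vassoc' rfl rfl, vreassoc hππ', id_vcomp, hψ]
  · rw [← hu (vcomp π θ rfl rfl), vreassoc hπ', id_vcomp]
    simp only
    rw [← hθ, ← hφ', vassoc' rfl rfl]

/-- An equipment satisfying Wood's axiom is exact. -/
theorem WoodAxiom5.isExact (hD : IsEquipment D) (hW : WoodAxiom5 D) : IsExact D where
  regular :=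
    { collapse := fun M _ => by
        obtain ⟨q, i, I, hI, hK, -, -⟩ := hW.exists_universal hD M
        -- Normality is the bimodule statement for the unit bimodule, whose embedding `I.cell` is
        -- cartesian because `I` is a kernel.
        exact ⟨q, i, I, hI, hW.isBimodCollapse hD hI hI I.isBimodEmbedding_unit hK⟩
      bimodCollapse := by
        rintro c d c' d' f g ⟨_, _, hf, hf', -⟩ ⟨_, _, hg, hg', -⟩ B K L F G hF hG R φ hφ hφc
        exact hW.isBimodCollapse hD (hF.isCollapse hf hf') (hG.isCollapse hg hg') hφ hφc }
  monEffective M := by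
    obtain ⟨q, i, I, -, hK, -, -⟩ := hW.exists_universal hD M
    exact ⟨q, i, I, hK⟩
  bimodEffective {c d M N} B := by
    obtain ⟨q, i, I, -, hI, H, -⟩ := hW.exists_universal hD M
    obtain ⟨r, j, J, -, hJ, -, H'⟩ := hW.exists_universal hD N
    obtain ⟨P, φ, hl, hr, hφ⟩ := exists_bimod_cartesian hD H H' (X := Bimod.pro B)
      ⟨B.unit_l, B.mul_l⟩ ⟨B.r_unit, B.r_mul⟩ B.l_r
    exact ⟨q, r, i, j, I, J, P, φ, hI, hJ, ⟨hl, hr⟩, hφ⟩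

end WoodExact

end DoubleCategory

theorem mainTheorem2 {D : Type*} [DoubleCategory D] (hD : DoubleCategory.IsEquipment D) :
    DoubleCategory.IsExact D ↔ DoubleCategory.WoodAxiom5 D :=
  ⟨fun h => h.woodAxiom5 hD, fun h => h.isExact hD⟩
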